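/- Let $k\ge 1$ and $n\ge 0$ be integers, let $Z_k=\{u\in\mathbb C: u^k=1\}$, and let $Z_k\wr S_n$ be the group of $n\times n$ matrices with exactly one nonzero entry in every row and column, these entries lying in $Z_k$. An element $\sigma$ has an underlying permutation in $S_n$, whose cycles are called the cycles of $\sigma$; write $u(\sigma,i)\in Z_k$ for its nonzero entry in row $i$. For a $k$-multipartition $\vec\gamma=(\gamma^0,\dots,\gamma^{k-1})$ of $n$ (a sequence of possibly empty partitions with $\sum_r|\gamma^r|=n$), let $\chi^{\vec\gamma}$ be the irreducible character of $Z_k\wr S_n$ indexed by $\vec\gamma$: the character induced from $\prod_r Z_k\wr S_{|\gamma^r|}$ by the outer product over $r$ of the irreducible $S_{|\gamma^r|}$-characters $\chi^{\gamma^r}$ (with $\chi^{(m)}$ trivial), each twisted by $\sigma\mapsto\prod_i u(\sigma,i)^r$. Concretely, $\chi^{\vec\gamma}$ is the character of the left ideal of $\mathbb C[Z_k\wr S_n]$ generated by the corresponding Young symmetrizer. Let $R$ be a commutative $\mathbb C$-algebra with a Hausdorff ring topology (for instance any commutative $\mathbb C$-algebra with the discrete topology); sums are unordered sums in $R$, so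 finite sums are the usual ones. A color rule $F$ is a multiset, possibly with infinitely many different elements, of elements (colors) of a linearly ordered set $C$, each color having a finite multiplicity. Let $p:C\to\mathbb Z$ (value) and $\rho:C\to R$ (weight) be functions. A coloring of $\sigma\in Z_k\wr S_n$ is a sequence $g=(g_1,\dots,g_n)$ of colors that uses no color more often than its multiplicity in $F$ and satisfies $g_i=g_j$ whenever $i$ and $j$ lie in the same cycle of $\sigma$. Suppose that $\chi:Z_k\wr S_n\to R$ is given by $F$ with value $p$ and weight $\rho$, that is, for every $\sigma$ the following sum converges and $$\chi(\sigma)=\sum_{g\text{ coloring of }\sigma}\ \prod_{i=1}^n u(\sigma,i)^{p(g_i)}\rho(g_i).$$ For a multipartition $\vec\gamma$, let $\mathrm{SSYT}_k(\vec\gamma,F)$ be the set of fillings $T$ of the cells of $\gamma^0,\dots,\gamma^{k-1}$ by colors such that, in each $\gamma^r$ drawn in French notation, rows increase weakly from left to right and columns increase strictly from bottom to top, every color $f$ occurring in $\gamma^r$ satisfies $p(f)\equiv r \pmod k$, and no color is used more often than its multiplicity in $F$. Let $\rho(T)$ be the product of the weights $\rho$ of the entries of $T$, over all cells. Then for every $k$-multipartition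 $\vec\gamma$ of $n$ the sum on the right-hand side below converges and $$\langle\chi,\chi^{\vec\gamma}\rangle:=\frac1{n!\,k^n}\sum_{\sigma\in Z_k\wr S_n}\chi(\sigma)\,\overline{\chi^{\vec\gamma}(\sigma)}=\sum_{T\in \mathrm{SSYT}_k(\vec\gamma,F)}\rho(T).$$ -/

import Mathlib

/-- The wreath product `Z_k ≀ S_n`, where `Z_k` is the group of `k`-th roots of unity in `ℂ`:
the semidirect product of `Z_k ^ n` with `S_n` permuting the coordinates. The element `⟨v, π⟩`
corresponds to the monomial matrix `diag(v) * P_π`, whose nonzero entry in row `i` is `v i`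
and which sends the basis vector `e_i` to `v (π i) • e_(π i)`. -/
abbrev CyclicWreath (k n : ℕ) : Type :=
  (Fin n → rootsOfUnity k ℂ) ⋊[mulAutArrow] Equiv.Perm (Fin n)

noncomputable instance CyclicWreath.instFintypeRoots (k : ℕ) [NeZero k] :
    Fintype (rootsOfUnity k ℂ) :=
  Fintype.ofFinite _

noncomputable instance CyclicWreath.instFintype (k n : ℕ) [NeZero k] :
    Fintype (CyclicWreath k n) :=
  Fintype.ofEquiv _ (SemidirectProduct.equivProd (N := Fin n → rootsOfUnity k ℂ)
    (G := Equiv.Perm (Fin n)) (φ := mulAutArrow)).symm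

/-- A `k`-multipartition of `n`: a sequence of `k` (possibly empty) partitions, given by their
Young diagrams, with `n` cells in total. A cell is a pair `(row, column)`, counted from `0`;
row `0` is the longest row. -/
structure Multipartition (k n : ℕ) where
  shape : Fin k → YoungDiagram
  card_shape : ∑ r, (shape r).card = n

namespace Multipartition

variable {k n : ℕ}

/-- The cells of a multipartition: a component `r` and a cell of the `r`-th diagram. -/
abbrev Cell (γ : Multipartition k n) : Type := Σ r : Fin k, (γ.shape r).cells

theorem card_cell (γ : Multipartition k n) : Fintype.card γ.Cell = n := by
  simpa [YoungDiagram.card] using γ.card_shape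

/-- A fixed bijective filling of the cells of `γ` by the `n` indices. (The isomorphism class of
the representation below does not depend on which one is taken.) -/
noncomputable def filling (γ : Multipartition k n) : γ.Cell ≃ Fin n :=
  Fintype.equivFinOfCardEq γ.card_cell

/-- The component of `γ` that contains the index `i`. -/
noncomputable def comp (γ : Multipartition k n) (i : Fin n) : Fin k :=
  (γ.filling.symm i).1

/-- The row (component and row number) that contains the index `i`. -/
noncomputable def row (γ : Multipartition k n) (i : Fin n) : Fin k × ℕ :=
  (γ.comp i, (γ.filling.symm i).2.1.1)

/-- The column (component and column number) that contains the index `i`. -/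
noncomputable def col (γ : Multipartition k n) (i : Fin n) : Fin k × ℕ :=
  (γ.comp i, (γ.filling.symm i).2.1.2)

/-- The permutations that preserve every row. -/
noncomputable def rowPerms (γ : Multipartition k n) : Finset (Equiv.Perm (Fin n)) :=
  Finset.univ.filter fun π => ∀ i, γ.row (π i) = γ.row i

/-- The permutations that preserve every column. -/
noncomputable def colPerms (γ : Multipartition k n) : Finset (Equiv.Perm (Fin n)) :=
  Finset.univ.filter fun π => ∀ i, γ.col (π i) = γ.col i

/-- The Young symmetrizer of `γ` in the group algebra of `Z_k ≀ S_n`: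
`(∑ v, (∏ i, (v i) ^ (-comp i)) v) * (∑ p in rows, p) * (∑ q in columns, sgn q • q)`. The first
factor is a multiple of the idempotent of the character `⨂ i, Ψ^(comp i)` of `Z_k ^ n`, where
`Ψ^r (u) = u ^ r`. -/
noncomputable def youngSymmetrizer [NeZero k] (γ : Multipartition k n) :
    MonoidAlgebra ℂ (CyclicWreath k n) :=
  ∑ v : Fin n → rootsOfUnity k ℂ, ∑ p ∈ γ.rowPerms, ∑ q ∈ γ.colPerms,
    MonoidAlgebra.single (⟨v, p * q⟩ : CyclicWreath k n)
      ((∏ i, (((v i : ℂˣ) : ℂ) ^ (γ.comp i : ℕ))⁻¹) * ((Equiv.Perm.sign q : ℤ) : ℂ))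

/-- The (generalized Specht) module of `γ`: the left ideal of the group algebra generated by the
Young symmetrizer. It is the irreducible representation of `Z_k ≀ S_n` indexed by `γ`, i.e. the
one induced from `∏ r, Z_k ≀ S_(|γ^r|)` by the outer tensor product of the Specht modules of the
`γ^r`, twisted by `Ψ^r`. -/
noncomputable abbrev spechtModule [NeZero k] (γ : Multipartition k n) :
    Submodule (MonoidAlgebra ℂ (CyclicWreath k n)) (MonoidAlgebra ℂ (CyclicWreath k n)) :=
  Submodule.span (MonoidAlgebra ℂ (CyclicWreath k n)) {γ.youngSymmetrizer}

/-- The irreducible character `χ^γ` of `Z_k ≀ S_n`: the trace of left multiplication on the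
module of `γ`. -/
noncomputable def irrChar [NeZero k] (γ : Multipartition k n) (σ : CyclicWreath k n) : ℂ :=
  (Representation.ofModule' (k := ℂ) (G := CyclicWreath k n) γ.spechtModule).character σ

end Multipartition

/-- The inner product `|G|⁻¹ ∑ σ, χ(σ) * conj(ψ(σ))` on `G = Z_k ≀ S_n` of an `R`-valued function
and a complex-valued one, where `R` is a commutative `ℂ`-algebra. -/
noncomputable def wreathInner {k n : ℕ} [NeZero k] {R : Type*} [CommRing R] [Algebra ℂ R]
    (χ : CyclicWreath k n → R) (ψ : CyclicWreath k n → ℂ) : R :=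
  ((Fintype.card (CyclicWreath k n) : ℂ)⁻¹) •
    ∑ σ : CyclicWreath k n, χ σ * algebraMap ℂ R (starRingEnd ℂ (ψ σ))

/-- A color rule on a type `C` of colors: a multiset of colors, possibly with infinitely many
different ones. The color `c` occurs `F c` times. -/
abbrev ColorRule (C : Type*) : Type _ := C → ℕ

namespace ColorRule

variable {C : Type*} {k n : ℕ}

/-- The colorings of `σ` under `F`: every index gets a color, indices in the same cycle get the
same color, and every color `c` is used at most `F c` times. -/
def Coloring (F : ColorRule C) (σ : CyclicWreath k n) : Type _ :=
  {g : Fin n → C // (∀ c, Set.ncard {i | g i = c} ≤ F c) ∧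
    ∀ i j, σ.right.SameCycle i j → g i = g j}

/-- The weight `∏ i, u(σ,i) ^ p(g_i) * ρ(g_i)` of a coloring `g` of `σ`. -/
noncomputable def colorWeight {R : Type*} [CommRing R] [Algebra ℂ R] (p : C → ℤ) (ρ : C → R)
    (σ : CyclicWreath k n) (g : Fin n → C) : R :=
  ∏ i, algebraMap ℂ R (((σ.left i : ℂˣ) : ℂ) ^ p (g i)) * ρ (g i)

/-- The function `χ` is given by the color rule `F` with value `p` and weight `ρ`: for every `σ`,
`χ σ` is the sum of the weights of the colorings of `σ`. The sum may be infinite; it is taken in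
the topology of `R`. -/
def Gives {R : Type*} [CommRing R] [Algebra ℂ R] [TopologicalSpace R]
    (F : ColorRule C) (p : C → ℤ) (ρ : C → R) (χ : CyclicWreath k n → R) : Prop :=
  ∀ σ, HasSum (fun g : F.Coloring σ => colorWeight p ρ σ g.1) (χ σ)

/-- The submultiset `F_r` of the colors of `F` whose value is congruent to `r` modulo `k`. -/
def restrict (F : ColorRule C) (p : C → ℤ) (r : Fin k) : ColorRule C :=
  fun c => if p c ≡ (r : ℤ) [ZMOD k] then F c else 0

/-- Semistandard tableaux of shape `μ` with entries from the multiset `F`: weakly increasing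
along rows, strictly increasing along columns (away from row `0`), and every `c` is used at most
`F c` times. -/
def SSYT [LinearOrder C] (F : ColorRule C) (μ : YoungDiagram) : Type _ :=
  {T : μ.cells → C //
    (∀ x y : μ.cells, x.1.1 = y.1.1 → x.1.2 < y.1.2 → T x ≤ T y) ∧
    (∀ x y : μ.cells, x.1.2 = y.1.2 → x.1.1 < y.1.1 → T x < T y) ∧
    ∀ c, Set.ncard {x | T x = c} ≤ F c}

/-- `SSYT_k(γ, F) = SSYT(γ^0, F_0) × ⋯ × SSYT(γ^(k-1), F_(k-1))`. -/
def SSYTk [LinearOrder C] (F : ColorRule C) (p : C → ℤ) (γ : Multipartition k n) : Type _ :=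
  ∀ r : Fin k, (F.restrict p r).SSYT (γ.shape r)

/-- The weight `ρ(T)`: the product of the weights of the entries of `T`, over all cells. -/
def tableauWeight [LinearOrder C] {R : Type*} [CommRing R] {F : ColorRule C} {p : C → ℤ}
    {γ : Multipartition k n} (ρ : C → R) (T : F.SSYTk p γ) : R :=
  ∏ r : Fin k, ∏ x : (γ.shape r).cells, ρ ((T r).1 x)

end ColorRule

/-!
The proof computes the coefficient of each monomial in the weights on both sides. Expanding
`χ` by colorings turns the inner product into a sum over all words
`g : Fin n → C`, in which the coefficient of `∏ i, ρ (g i)` is, up to the factor `|G|⁻¹` with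
`G = Z_k ≀ S_n`, the number `wordCoeff`. On a finite set `O` of words closed under permutations of
the places, these numbers add up to the inner product of `χ^γ` with the character of a monomial
representation `wordRep` on the functions on `O`, and the task is to show that this multiplicity
is the number of semistandard words in `O`.

The multiplicity is a rank. By von Neumann's lemma (`exists_rowSum_mul_mul_colSum`) the Young
symmetrizer `e` satisfies `e * e = c • e`, where `c ≠ 0` because `e` has coefficient `1` at the
identity and so cannot be nilpotent. Hence `χ^γ` is a trace on the whole group algebra
(`MonoidAlgebra.mul_character_span_singleton`), and its multiplicity in a representation is the
rank of `e` there (`sum_character_mul_conj_irrChar`). On `wordRep`, the diagonal factor of `e`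
kills the words whose values do not match the components, and the remaining row and column sums
map a word `T` to `tabVector O T`.

The vectors of the semistandard words are a basis of the image. They span it by the classical
straightening algorithm with Garnir relations (`tabVector_mem_span`), and they are independent
because their matrix is triangular for a weight that sorting a column increases
(`linearIndependent_tabVector`).

It remains to pass to infinite sums in a ring that need not be complete. The coefficient of a word
is the proportion of semistandard words among its rearrangements (`wordCoeff_eq`), so the sum over
all words spreads the weight of each tableau evenly over the rearrangements of its word. As there
are at most `n!` of them, the sum can be concentrated on the semistandard words again
(`hasSum_of_hasSum_average`).
-/

/-! ### Finite sums of integers -/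

/-- Replacing elements of `s` on which `f` is less than `m` by elements on which it is at least
`m` increases the sum of `f`. -/
theorem Finset.sum_lt_sum_of_exchange {ι : Type*} [DecidableEq ι] {s t : Finset ι} {f : ι → ℕ}
    (hcard : s.card = t.card) (hne : s ≠ t) (m : ℕ) (ht : ∀ x ∈ t \ s, m ≤ f x)
    (hs : ∀ x ∈ s \ t, f x < m) : ∑ x ∈ s, f x < ∑ x ∈ t, f x := by
  have hc : (s \ t).card = (t \ s).card := Finset.card_sdiff_comm hcard
  have hnon : (s \ t).Nonempty := by
    rw [Finset.nonempty_iff_ne_empty, Ne, Finset.sdiff_eq_empty_iff_subset]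
    exact fun h => hne (Finset.eq_of_subset_of_card_le h hcard.ge)
  rw [← Finset.sum_inter_add_sum_sdiff s t, ← Finset.sum_inter_add_sum_sdiff t s,
    Finset.inter_comm t s]
  refine Nat.add_lt_add_left ?_ _
  calc ∑ x ∈ s \ t, f x < ∑ _x ∈ s \ t, m := Finset.sum_lt_sum_of_nonempty hnon hs
    _ = ∑ _x ∈ t \ s, m := by simp [hc]
    _ ≤ ∑ x ∈ t \ s, f x := Finset.sum_le_sum ht

/-- The rearrangement inequality, fibre by fibre: the permutation preserves the fibres of `κ`, and
the two functions only have to be sorted alike on each fibre. -/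
theorem sum_mul_comp_perm_le_of_fiberwise {ι β : Type*} [Fintype ι] (κ : ι → β) (q : Equiv.Perm ι)
    (hq : ∀ i, κ (q i) = κ i) (f h : ι → ℤ)
    (hmono : ∀ i j, κ i = κ j → h i < h j → f i ≤ f j) :
    ∑ i, f i * h (q i) ≤ ∑ i, f i * h i := by
  classical
  have hmaps : ∀ i ∈ (Finset.univ : Finset ι), κ i ∈ Finset.univ.image κ := by simp
  rw [← Finset.sum_fiberwise_of_maps_to hmaps, ← Finset.sum_fiberwise_of_maps_to hmaps]
  refine Finset.sum_le_sum fun b _ => ?_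
  set s : Finset ι := Finset.univ.filter fun i => κ i = b with hs
  have hqs : ∀ i, κ i = b ↔ κ (q i) = b := fun i => by rw [hq]
  -- the permutation of the fibre over `b`, extended by the identity
  let τ : Equiv.Perm ι := Equiv.Perm.ofSubtype (q.subtypePerm (p := fun i => κ i = b)
    (fun i => (hqs i).symm))
  have hτ : ∀ i ∈ s, τ i = q i := by
    intro i hi
    have hi' : κ i = b := by simpa [hs] using hi
    simp [τ, Equiv.Perm.ofSubtype_apply_of_mem, hi']
  have hsupp : {x | τ x ≠ x} ⊆ (s : Set ι) := by
    intro x hx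
    by_contra hxs
    exact hx (Equiv.Perm.ofSubtype_apply_of_not_mem _ (by simpa [hs] using hxs))
  have hmv : MonovaryOn f h s := by
    intro i hi j hj hij
    have hi' : κ i = b := by simpa [hs] using hi
    have hj' : κ j = b := by simpa [hs] using hj
    exact hmono i j (hi'.trans hj'.symm) hij
  calc ∑ i ∈ s, f i * h (q i) = ∑ i ∈ s, f i * h (τ i) :=
        Finset.sum_congr rfl fun i hi => by rw [hτ i hi]
    _ ≤ ∑ i ∈ s, f i * h i := hmv.sum_mul_comp_perm_le_sum_mul hsupp

/-- The strict case: if `f` is strictly sorted like `g` on each fibre and separates the points of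
each fibre, then only the identity attains the maximum. -/
theorem eq_one_of_sum_le_sum_mul_comp_perm {ι β : Type*} [Fintype ι] (κ : ι → β)
    (q : Equiv.Perm ι) (hq : ∀ i, κ (q i) = κ i) (f g : ι → ℕ)
    (hinj : ∀ i j, κ i = κ j → f i = f j → i = j)
    (hmono : ∀ i j, κ i = κ j → f i < f j → g i < g j)
    (hle : ∑ i, f i * g i ≤ ∑ i, f i * g (q i)) : q = 1 := by
  classical
  -- `M * g - f` is still weakly sorted like `f` when `M` exceeds all values of `f`, so the
  -- weak inequality applies to it; the rest, `∑ f * f`, is controlled by a sum of squares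
  set M : ℕ := ∑ i, f i + 1 with hM
  have hfM : ∀ i, f i < M := fun i =>
    Nat.lt_succ_of_le (Finset.single_le_sum (f := f) (fun _ _ => Nat.zero_le _)
      (Finset.mem_univ i))
  have hweak := sum_mul_comp_perm_le_of_fiberwise κ q hq (fun i => (f i : ℤ))
    (fun i => (M : ℤ) * g i - f i) (by
      intro i j hij hlt
      by_contra hcon
      have hji : f j < f i := by exact_mod_cast not_le.mp hcon
      have h1 : g j + 1 ≤ g i := hmono j i hij.symm hji
      have h2 : (M : ℤ) * (g j + 1) ≤ M * g i := by
        refine mul_le_mul_of_nonneg_left (by exact_mod_cast h1) (by positivity)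
      have h3 : (f i : ℤ) < M := by exact_mod_cast hfM i
      have h4 : (0 : ℤ) ≤ f j := by positivity
      linarith)
  have hsq : ∑ i, (f (q i) : ℤ) ^ 2 = ∑ i, (f i : ℤ) ^ 2 :=
    Equiv.sum_comp q fun i => (f i : ℤ) ^ 2
  have hle' : ∑ i, (f i : ℤ) * g i ≤ ∑ i, (f i : ℤ) * g (q i) := by exact_mod_cast hle
  have hzero : ∑ i, ((f i : ℤ) - f (q i)) ^ 2 ≤ 0 := by
    have e1 : ∑ i, ((f i : ℤ) - f (q i)) ^ 2
        = ∑ i, (f i : ℤ) ^ 2 + ∑ i, (f (q i) : ℤ) ^ 2 - 2 * ∑ i, (f i : ℤ) * f (q i) := by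
      rw [Finset.mul_sum, ← Finset.sum_add_distrib, ← Finset.sum_sub_distrib]
      exact Finset.sum_congr rfl fun i _ => by ring
    have e2 : ∑ i, (f i : ℤ) * ((M : ℤ) * g (q i) - f (q i))
        = M * ∑ i, (f i : ℤ) * g (q i) - ∑ i, (f i : ℤ) * f (q i) := by
      rw [Finset.mul_sum, ← Finset.sum_sub_distrib]
      exact Finset.sum_congr rfl fun i _ => by ring
    have e3 : ∑ i, (f i : ℤ) * ((M : ℤ) * g i - f i)
        = M * ∑ i, (f i : ℤ) * g i - ∑ i, (f i : ℤ) ^ 2 := by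
      rw [Finset.mul_sum, ← Finset.sum_sub_distrib]
      exact Finset.sum_congr rfl fun i _ => by ring
    have e4 := mul_le_mul_of_nonneg_left hle' (by positivity : (0 : ℤ) ≤ M)
    rw [e2, e3] at hweak
    rw [e1, hsq]
    linarith
  ext i
  have hi : ((f i : ℤ) - f (q i)) ^ 2 = 0 :=
    (Finset.sum_eq_zero_iff_of_nonneg fun _ _ => sq_nonneg _).mp
      (le_antisymm hzero (Finset.sum_nonneg fun _ _ => sq_nonneg _)) i (Finset.mem_univ i)
  have hi' : f i = f (q i) := by
    have := pow_eq_zero_iff (two_ne_zero) |>.mp hi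
    omega
  rw [Equiv.Perm.one_apply, hinj (q i) i (hq i) hi'.symm]

/-! ### Cells of a multipartition -/

namespace Multipartition

variable {k n : ℕ} (γ : Multipartition k n)

/-- The row number of the cell containing the index `i`. -/
noncomputable def rowNum (i : Fin n) : ℕ := (γ.row i).2

/-- The column number of the cell containing the index `i`. -/
noncomputable def colNum (i : Fin n) : ℕ := (γ.col i).2

theorem row_eq_iff {i j : Fin n} :
    γ.row i = γ.row j ↔ γ.comp i = γ.comp j ∧ γ.rowNum i = γ.rowNum j := by
  simp [row, rowNum, Prod.ext_iff]

theorem col_eq_iff {i j : Fin n} :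
    γ.col i = γ.col j ↔ γ.comp i = γ.comp j ∧ γ.colNum i = γ.colNum j := by
  simp [col, colNum, Prod.ext_iff]

theorem rowNum_colNum_mem (i : Fin n) : (γ.rowNum i, γ.colNum i) ∈ γ.shape (γ.comp i) :=
  (γ.filling.symm i).2.2

theorem exists_index {x : Fin k} {r c : ℕ} (h : (r, c) ∈ γ.shape x) :
    ∃ i, γ.comp i = x ∧ γ.rowNum i = r ∧ γ.colNum i = c :=
  ⟨γ.filling ⟨x, ⟨(r, c), h⟩⟩, by
    simp only [comp, rowNum, row, colNum, col]
    rw [Equiv.symm_apply_apply]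
    exact ⟨rfl, rfl, rfl⟩⟩

theorem index_ext {i j : Fin n} (hx : γ.comp i = γ.comp j) (hr : γ.rowNum i = γ.rowNum j)
    (hc : γ.colNum i = γ.colNum j) : i = j := by
  apply γ.filling.symm.injective
  simp only [comp, rowNum, row, colNum, col] at hx hr hc
  generalize γ.filling.symm i = a at *
  generalize γ.filling.symm j = b at *
  obtain ⟨x, ⟨⟨r, c⟩, ha⟩⟩ := a
  obtain ⟨y, ⟨⟨r', c'⟩, hb⟩⟩ := b
  simp only at hx hr hc
  subst hx hr hc
  rfl

theorem mem_rowPerms {π : Equiv.Perm (Fin n)} : π ∈ γ.rowPerms ↔ ∀ i, γ.row (π i) = γ.row i := by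
  simp [rowPerms]

theorem mem_colPerms {π : Equiv.Perm (Fin n)} : π ∈ γ.colPerms ↔ ∀ i, γ.col (π i) = γ.col i := by
  simp [colPerms]

theorem mul_mem_rowPerms {π τ : Equiv.Perm (Fin n)} (hπ : π ∈ γ.rowPerms) (hτ : τ ∈ γ.rowPerms) :
    π * τ ∈ γ.rowPerms :=
  γ.mem_rowPerms.2 fun i => by
    rw [Equiv.Perm.mul_apply, γ.mem_rowPerms.1 hπ, γ.mem_rowPerms.1 hτ]

theorem mul_mem_colPerms {π τ : Equiv.Perm (Fin n)} (hπ : π ∈ γ.colPerms) (hτ : τ ∈ γ.colPerms) :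
    π * τ ∈ γ.colPerms :=
  γ.mem_colPerms.2 fun i => by
    rw [Equiv.Perm.mul_apply, γ.mem_colPerms.1 hπ, γ.mem_colPerms.1 hτ]

theorem inv_mem_rowPerms {π : Equiv.Perm (Fin n)} (hπ : π ∈ γ.rowPerms) : π⁻¹ ∈ γ.rowPerms :=
  γ.mem_rowPerms.2 fun i => by
    rw [← γ.mem_rowPerms.1 hπ (π⁻¹ i), Equiv.Perm.coe_inv, Equiv.apply_symm_apply]

theorem inv_mem_colPerms {π : Equiv.Perm (Fin n)} (hπ : π ∈ γ.colPerms) : π⁻¹ ∈ γ.colPerms :=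
  γ.mem_colPerms.2 fun i => by
    rw [← γ.mem_colPerms.1 hπ (π⁻¹ i), Equiv.Perm.coe_inv, Equiv.apply_symm_apply]

theorem one_mem_rowPerms : (1 : Equiv.Perm (Fin n)) ∈ γ.rowPerms := by simp [mem_rowPerms]

theorem one_mem_colPerms : (1 : Equiv.Perm (Fin n)) ∈ γ.colPerms := by simp [mem_colPerms]

theorem comp_of_mem_rowPerms {π : Equiv.Perm (Fin n)} (hπ : π ∈ γ.rowPerms) (i : Fin n) :
    γ.comp (π i) = γ.comp i :=
  (γ.row_eq_iff.1 (γ.mem_rowPerms.1 hπ i)).1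

theorem comp_of_mem_colPerms {π : Equiv.Perm (Fin n)} (hπ : π ∈ γ.colPerms) (i : Fin n) :
    γ.comp (π i) = γ.comp i :=
  (γ.col_eq_iff.1 (γ.mem_colPerms.1 hπ i)).1

theorem swap_mem_rowPerms {i j : Fin n} (h : γ.row i = γ.row j) :
    Equiv.swap i j ∈ γ.rowPerms := by
  refine γ.mem_rowPerms.2 fun x => ?_
  by_cases hi : x = i
  · simp [hi, h]
  · by_cases hj : x = j
    · simp [hj, h]
    · rw [Equiv.swap_apply_of_ne_of_ne hi hj]

theorem swap_mem_colPerms {i j : Fin n} (h : γ.col i = γ.col j) :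
    Equiv.swap i j ∈ γ.colPerms := by
  refine γ.mem_colPerms.2 fun x => ?_
  by_cases hi : x = i
  · simp [hi, h]
  · by_cases hj : x = j
    · simp [hj, h]
    · rw [Equiv.swap_apply_of_ne_of_ne hi hj]

/-- A permutation that preserves the rows and the columns is the identity. -/
theorem eq_one_of_mem_rowPerms_of_mem_colPerms {π : Equiv.Perm (Fin n)} (hr : π ∈ γ.rowPerms)
    (hc : π ∈ γ.colPerms) : π = 1 := by
  ext i
  rw [Equiv.Perm.one_apply, γ.index_ext (γ.comp_of_mem_rowPerms hr i)
    (γ.row_eq_iff.1 (γ.mem_rowPerms.1 hr i)).2 (γ.col_eq_iff.1 (γ.mem_colPerms.1 hc i)).2]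

/-- The column numbers of the cells in one row are `0, …, L - 1`. -/
theorem image_colNum_row (i : Fin n) :
    (Finset.univ.filter fun j => γ.row j = γ.row i).image γ.colNum
      = Finset.range (Finset.univ.filter fun j => γ.row j = γ.row i).card := by
  have h : (Finset.univ.filter fun j => γ.row j = γ.row i).image γ.colNum
      = Finset.range ((γ.shape (γ.comp i)).rowLen (γ.rowNum i)) := by
    ext c
    simp only [Finset.mem_image, Finset.mem_filter, Finset.mem_univ, true_and, Finset.mem_range,
      ← YoungDiagram.mem_iff_lt_rowLen]
    constructor
    · rintro ⟨j, hj, rfl⟩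
      rw [row_eq_iff] at hj
      rw [← hj.1, ← hj.2]
      exact γ.rowNum_colNum_mem j
    · intro h
      obtain ⟨j, hx, hr, hc⟩ := γ.exists_index h
      exact ⟨j, γ.row_eq_iff.2 ⟨hx, hr⟩, hc⟩
  have hcard := congrArg Finset.card h
  rw [Finset.card_range, Finset.card_image_of_injOn] at hcard
  · rw [h, hcard]
  · intro a ha b hb hab
    simp only [Finset.coe_filter, Finset.mem_univ, true_and, Set.mem_ofPred_eq] at ha hb
    have := γ.row_eq_iff.1 (ha.trans hb.symm)
    exact γ.index_ext this.1 this.2 hab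

/-- If `π` preserves the components and never moves two indices of one column into one row, then
it is the product of a row permutation and a column permutation. -/
theorem exists_mul_eq_of_injOn {π : Equiv.Perm (Fin n)} (hπ : ∀ i, γ.comp (π i) = γ.comp i)
    (hinj : ∀ i j, γ.row i = γ.row j → γ.col (π⁻¹ i) = γ.col (π⁻¹ j) → i = j) :
    ∃ p ∈ γ.rowPerms, ∃ q ∈ γ.colPerms, π = p * q := by
  classical
  have hπ' : ∀ i, γ.comp (π⁻¹ i) = γ.comp i := fun i => by
    rw [← hπ (π⁻¹ i), Equiv.Perm.coe_inv, Equiv.apply_symm_apply]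
  set w : Fin n → ℕ := fun i => γ.colNum (π⁻¹ i) with hw
  let rowOf : Fin k × ℕ → Finset (Fin n) := fun ρ => Finset.univ.filter fun j => γ.row j = ρ
  have hwinj : ∀ ρ, Set.InjOn w (rowOf ρ) := by
    intro ρ a ha b hb hab
    simp only [rowOf, Finset.coe_filter, Finset.mem_univ, true_and, Set.mem_ofPred_eq] at ha hb
    have hrow := ha.trans hb.symm
    exact hinj a b hrow (γ.col_eq_iff.2 ⟨by rw [hπ', hπ', (γ.row_eq_iff.1 hrow).1], hab⟩)
  have hcinj : ∀ ρ, Set.InjOn γ.colNum (rowOf ρ) := by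
    intro ρ a ha b hb hab
    simp only [rowOf, Finset.coe_filter, Finset.mem_univ, true_and, Set.mem_ofPred_eq] at ha hb
    have := γ.row_eq_iff.1 (ha.trans hb.symm)
    exact γ.index_ext this.1 this.2 hab
  have hmaps : ∀ i ∈ (Finset.univ : Finset (Fin n)), γ.row i ∈ Finset.univ.image γ.row := by simp
  -- `w` takes `L` different values on a row of length `L`, so its sum there is at least
  -- `0 + ⋯ + (L - 1)`, with equality only if the values are `0, …, L - 1`
  have hlt : ∀ i, (rowOf (γ.row i)).image w ≠ (rowOf (γ.row i)).image γ.colNum →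
      ∑ j ∈ rowOf (γ.row i), γ.colNum j < ∑ j ∈ rowOf (γ.row i), w j := by
    intro i hne
    rw [← Finset.sum_image (f := fun x => x) (hcinj _), ← Finset.sum_image (f := fun x => x)
      (hwinj _)]
    have himg : (rowOf (γ.row i)).image γ.colNum = Finset.range (rowOf (γ.row i)).card :=
      γ.image_colNum_row i
    refine Finset.sum_lt_sum_of_exchange ?_ hne.symm (rowOf (γ.row i)).card ?_ ?_
    · rw [Finset.card_image_of_injOn (hcinj _), Finset.card_image_of_injOn (hwinj _)]
    · intro x hx
      rw [himg, Finset.mem_sdiff, Finset.mem_range, not_lt] at hx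
      exact hx.2
    · intro x hx
      rw [himg, Finset.mem_sdiff, Finset.mem_range] at hx
      exact hx.1
  have hsum : ∑ i, w i = ∑ i, γ.colNum i := Equiv.sum_comp π⁻¹ γ.colNum
  have himage : ∀ i, (rowOf (γ.row i)).image w = (rowOf (γ.row i)).image γ.colNum := by
    by_contra! hcon
    obtain ⟨i, hi⟩ := hcon
    refine absurd hsum (ne_of_gt ?_)
    rw [← Finset.sum_fiberwise_of_maps_to hmaps, ← Finset.sum_fiberwise_of_maps_to hmaps]
    refine Finset.sum_lt_sum (fun ρ hρ => ?_) ⟨γ.row i, by simp, hlt i hi⟩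
    obtain ⟨j, -, rfl⟩ := Finset.mem_image.1 hρ
    by_cases hj : (rowOf (γ.row j)).image w = (rowOf (γ.row j)).image γ.colNum
    · refine le_of_eq ?_
      change ∑ j ∈ rowOf (γ.row j), γ.colNum j = ∑ j ∈ rowOf (γ.row j), w j
      rw [← Finset.sum_image (f := fun x => x) (hcinj _), ← Finset.sum_image (f := fun x => x)
        (hwinj _), hj]
    · exact (hlt j hj).le
  have hex : ∀ i, ∃ j, γ.row j = γ.row i ∧ γ.colNum j = w i := by
    intro i
    have hi : w i ∈ (rowOf (γ.row i)).image γ.colNum := by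
      rw [← himage i]
      exact Finset.mem_image_of_mem _ (by simp [rowOf])
    obtain ⟨j, hj, hjw⟩ := Finset.mem_image.1 hi
    exact ⟨j, by simpa [rowOf] using hj, hjw⟩
  choose p hprow hpcol using hex
  have hpinj : Function.Injective p := by
    intro a b hab
    have hrow : γ.row a = γ.row b := by rw [← hprow a, ← hprow b, hab]
    refine hwinj (γ.row b) (by simp [rowOf, hrow]) (by simp [rowOf]) ?_
    rw [← hpcol a, ← hpcol b, hab]
  let P : Equiv.Perm (Fin n) := Equiv.ofBijective p (Finite.injective_iff_bijective.1 hpinj)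
  have hP : P ∈ γ.rowPerms := γ.mem_rowPerms.2 hprow
  have hcol : ∀ i, γ.col (P i) = γ.col (π⁻¹ i) := fun i =>
    γ.col_eq_iff.2 ⟨by rw [γ.comp_of_mem_rowPerms hP, hπ'], hpcol i⟩
  have hmem : π⁻¹ * P⁻¹ ∈ γ.colPerms := γ.mem_colPerms.2 fun i => by
    rw [Equiv.Perm.mul_apply, ← hcol, Equiv.Perm.coe_inv, Equiv.apply_symm_apply]
  exact ⟨P⁻¹, γ.inv_mem_rowPerms hP, _, γ.inv_mem_colPerms hmem, by group⟩

end Multipartition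

/-! ### The Young symmetrizer is a multiple of an idempotent -/

namespace Multipartition

variable {k n : ℕ} (γ : Multipartition k n)

section Perm

variable {A : Type*} [Ring A] (f : Equiv.Perm (Fin n) →* A)

/-- The sum over the row permutations, in any algebra that `S_n` maps to. -/
noncomputable def rowSum : A := ∑ p ∈ γ.rowPerms, f p

theorem rowSum_mul {p : Equiv.Perm (Fin n)} (hp : p ∈ γ.rowPerms) :
    γ.rowSum f * f p = γ.rowSum f := by
  rw [rowSum, Finset.sum_mul]
  refine Finset.sum_bij' (fun x _ => x * p) (fun x _ => x * p⁻¹)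
    (fun x hx => γ.mul_mem_rowPerms hx hp)
    (fun x hx => γ.mul_mem_rowPerms hx (γ.inv_mem_rowPerms hp)) ?_ ?_ ?_
  · intro x _; group
  · intro x _; group
  · intro x _; rw [map_mul]

variable [Algebra ℂ A]

/-- The signed sum over the column permutations, in any algebra that `S_n` maps to. -/
noncomputable def colSum : A := ∑ q ∈ γ.colPerms, ((Equiv.Perm.sign q : ℤ) : ℂ) • f q

theorem mul_colSum {q : Equiv.Perm (Fin n)} (hq : q ∈ γ.colPerms) :
    f q * γ.colSum f = ((Equiv.Perm.sign q : ℤ) : ℂ) • γ.colSum f := by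
  rw [colSum, Finset.mul_sum, Finset.smul_sum]
  refine Finset.sum_bij' (fun x _ => q * x) (fun x _ => q⁻¹ * x)
    (fun x hx => γ.mul_mem_colPerms hq hx)
    (fun x hx => γ.mul_mem_colPerms (γ.inv_mem_colPerms hq) hx) ?_ ?_ ?_
  · intro x _; group
  · intro x _; group
  · intro x _
    rw [mul_smul_comm, smul_smul, ← map_mul]
    congr 1
    rw [Equiv.Perm.sign_mul]
    rcases Int.units_eq_one_or (Equiv.Perm.sign q) with h | h <;> simp [h]

/-- Von Neumann's lemma: between the row sum and the column sum, a permutation acts as a scalar.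
Either it moves two indices of one column into one row, and the product vanishes, or it is a row
permutation times a column permutation. -/
theorem exists_rowSum_mul_mul_colSum {π : Equiv.Perm (Fin n)}
    (hπ : ∀ i, γ.comp (π i) = γ.comp i) :
    ∃ s : ℂ, γ.rowSum f * f π * γ.colSum f = s • (γ.rowSum f * γ.colSum f) := by
  by_cases hinj : ∀ i j, γ.row i = γ.row j → γ.col (π⁻¹ i) = γ.col (π⁻¹ j) → i = j
  · obtain ⟨p, hp, q, hq, rfl⟩ := γ.exists_mul_eq_of_injOn hπ hinj
    refine ⟨((Equiv.Perm.sign q : ℤ) : ℂ), ?_⟩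
    rw [map_mul, ← mul_assoc, rowSum_mul γ f hp, mul_assoc, mul_colSum γ f hq, mul_smul_comm]
  · push Not at hinj
    obtain ⟨i, j, hrow, hcol, hij⟩ := hinj
    refine ⟨0, ?_⟩
    have ht : Equiv.swap i j * π = π * Equiv.swap (π⁻¹ i) (π⁻¹ j) := by
      rw [Equiv.swap_apply_apply, inv_inv]
      group
    have h : γ.rowSum f * f π * γ.colSum f = -(γ.rowSum f * f π * γ.colSum f) := by
      conv_lhs => rw [← rowSum_mul γ f (γ.swap_mem_rowPerms hrow), mul_assoc (γ.rowSum f),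
        ← map_mul, ht, map_mul, ← mul_assoc, mul_assoc, mul_colSum γ f (γ.swap_mem_colPerms hcol),
        Equiv.Perm.sign_swap (fun h => hij (π⁻¹.injective h))]
      simp
    have h2 : (2 : ℂ) • (γ.rowSum f * f π * γ.colSum f) = 0 := by
      rw [two_smul]
      nth_rewrite 1 [h]
      exact neg_add_cancel _
    rw [zero_smul]
    exact (smul_eq_zero_iff_right two_ne_zero).1 h2

theorem exists_rowSum_mul_colSum_sq :
    ∃ s : ℂ, γ.rowSum f * γ.colSum f * (γ.rowSum f * γ.colSum f)
      = s • (γ.rowSum f * γ.colSum f) := by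
  have h : ∀ q ∈ γ.colPerms, ∀ p ∈ γ.rowPerms, ∃ s : ℂ,
      γ.rowSum f * f (q * p) * γ.colSum f = s • (γ.rowSum f * γ.colSum f) := fun q hq p hp =>
    γ.exists_rowSum_mul_mul_colSum f fun i => by
      rw [Equiv.Perm.mul_apply, γ.comp_of_mem_colPerms hq, γ.comp_of_mem_rowPerms hp]
  choose! s hs using h
  refine ⟨∑ q ∈ γ.colPerms, ∑ p ∈ γ.rowPerms, ((Equiv.Perm.sign q : ℤ) : ℂ) * s q p, ?_⟩
  have hmid : γ.colSum f * γ.rowSum f = ∑ q ∈ γ.colPerms, ∑ p ∈ γ.rowPerms,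
      ((Equiv.Perm.sign q : ℤ) : ℂ) • f (q * p) := by
    rw [colSum, rowSum, Finset.sum_mul_sum]
    exact Finset.sum_congr rfl fun q _ => Finset.sum_congr rfl fun p _ => by
      rw [smul_mul_assoc, map_mul]
  rw [show γ.rowSum f * γ.colSum f * (γ.rowSum f * γ.colSum f)
    = γ.rowSum f * (γ.colSum f * γ.rowSum f) * γ.colSum f by simp only [mul_assoc], hmid]
  simp only [Finset.mul_sum, Finset.sum_mul, Finset.sum_smul]
  refine Finset.sum_congr rfl fun q hq => Finset.sum_congr rfl fun p hp => ?_
  rw [mul_smul_comm, smul_mul_assoc, hs q hq p hp, smul_smul]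

end Perm

/-- The coefficient of the diagonal matrix `v` in the first factor of the Young symmetrizer. -/
noncomputable def diagCoeff (v : Fin n → rootsOfUnity k ℂ) : ℂ :=
  ∏ i, (((v i : ℂˣ) : ℂ) ^ (γ.comp i : ℕ))⁻¹

theorem diagCoeff_mul (v w : Fin n → rootsOfUnity k ℂ) :
    γ.diagCoeff (v * w) = γ.diagCoeff v * γ.diagCoeff w := by
  simp only [diagCoeff, ← Finset.prod_mul_distrib, Pi.mul_apply]
  exact Finset.prod_congr rfl fun i _ => by push_cast; rw [mul_pow, mul_inv]

/-- The permutation matrices inside the group algebra. -/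
noncomputable def permHom (k n : ℕ) :
    Equiv.Perm (Fin n) →* MonoidAlgebra ℂ (CyclicWreath k n) :=
  (MonoidAlgebra.of ℂ (CyclicWreath k n)).comp SemidirectProduct.inr

theorem permHom_apply (π : Equiv.Perm (Fin n)) :
    permHom k n π = MonoidAlgebra.single (⟨1, π⟩ : CyclicWreath k n) 1 := rfl

variable [NeZero k]

/-- The first factor of the Young symmetrizer, a multiple of an idempotent of the group algebra
of `Z_k ^ n`. -/
noncomputable def diagSum : MonoidAlgebra ℂ (CyclicWreath k n) :=
  ∑ v : Fin n → rootsOfUnity k ℂ,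
    MonoidAlgebra.single (⟨v, 1⟩ : CyclicWreath k n) (γ.diagCoeff v)

theorem youngSymmetrizer_eq :
    γ.youngSymmetrizer = γ.diagSum * (γ.rowSum (permHom k n) * γ.colSum (permHom k n)) := by
  rw [youngSymmetrizer, diagSum, rowSum, colSum, Finset.sum_mul_sum, Finset.sum_mul]
  refine Finset.sum_congr rfl fun v _ => ?_
  rw [Finset.mul_sum]
  refine Finset.sum_congr rfl fun p _ => ?_
  rw [Finset.mul_sum]
  refine Finset.sum_congr rfl fun q _ => ?_
  rw [mul_smul_comm, ← map_mul, permHom_apply, mul_smul_comm, MonoidAlgebra.single_mul_single,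
    MonoidAlgebra.smul_single, mul_one, smul_eq_mul, mul_comm, diagCoeff]
  congr 1
  ext <;> simp

theorem diagSum_mul_diagSum : ∃ c : ℂ, γ.diagSum * γ.diagSum = c • γ.diagSum := by
  refine ⟨(Fintype.card (Fin n → rootsOfUnity k ℂ) : ℂ), ?_⟩
  have h : ∀ v : Fin n → rootsOfUnity k ℂ,
      MonoidAlgebra.single (⟨v, 1⟩ : CyclicWreath k n) (γ.diagCoeff v) * γ.diagSum
        = γ.diagSum := by
    intro v
    rw [diagSum, Finset.mul_sum]
    refine Fintype.sum_equiv (Equiv.mulLeft v) _ _ fun w => ?_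
    rw [MonoidAlgebra.single_mul_single, Equiv.coe_mulLeft, diagCoeff_mul]
    congr 1
  nth_rewrite 1 [diagSum]
  rw [Finset.sum_mul, Finset.sum_congr rfl fun v _ => h v]
  rw [Finset.sum_const, Finset.card_univ, Nat.cast_smul_eq_nsmul]

theorem permHom_mul_diagSum {π : Equiv.Perm (Fin n)} (hπ : ∀ i, γ.comp (π i) = γ.comp i) :
    permHom k n π * γ.diagSum = γ.diagSum * permHom k n π := by
  rw [diagSum, Finset.mul_sum, Finset.sum_mul]
  refine Fintype.sum_equiv (mulAutArrow (G := Equiv.Perm (Fin n)) π).toEquiv _ _ fun v => ?_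
  rw [permHom_apply, MonoidAlgebra.single_mul_single, MonoidAlgebra.single_mul_single]
  congr 1
  · ext <;> simp
  · rw [mul_one, one_mul, diagCoeff, diagCoeff]
    refine Fintype.prod_equiv π _ _ fun i => ?_
    have h : (mulAutArrow (G := Equiv.Perm (Fin n)) π) v (π i) = v i := by
      change v (π⁻¹ (π i)) = v i
      simp
    rw [MulEquiv.toEquiv_eq_coe, MulEquiv.coe_toEquiv, h, hπ]

theorem exists_youngSymmetrizer_sq :
    ∃ c : ℂ, γ.youngSymmetrizer * γ.youngSymmetrizer = c • γ.youngSymmetrizer := by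
  obtain ⟨c, hc⟩ := γ.diagSum_mul_diagSum
  obtain ⟨s, hs⟩ := γ.exists_rowSum_mul_colSum_sq (permHom k n)
  have hcomm : γ.rowSum (permHom k n) * γ.colSum (permHom k n) * γ.diagSum
      = γ.diagSum * (γ.rowSum (permHom k n) * γ.colSum (permHom k n)) := by
    have h1 : γ.colSum (permHom k n) * γ.diagSum = γ.diagSum * γ.colSum (permHom k n) := by
      rw [colSum, Finset.mul_sum, Finset.sum_mul]
      exact Finset.sum_congr rfl fun q hq => by
        rw [smul_mul_assoc, mul_smul_comm, γ.permHom_mul_diagSum (γ.comp_of_mem_colPerms hq)]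
    have h2 : γ.rowSum (permHom k n) * γ.diagSum = γ.diagSum * γ.rowSum (permHom k n) := by
      rw [rowSum, Finset.mul_sum, Finset.sum_mul]
      exact Finset.sum_congr rfl fun p hp =>
        γ.permHom_mul_diagSum (γ.comp_of_mem_rowPerms hp)
    rw [mul_assoc, h1, ← mul_assoc, h2, mul_assoc]
  refine ⟨c * s, ?_⟩
  rw [youngSymmetrizer_eq]
  generalize γ.rowSum (permHom k n) * γ.colSum (permHom k n) = y at *
  rw [mul_assoc, ← mul_assoc y, hcomm, mul_assoc, hs, ← mul_assoc, hc]
  rw [mul_smul_comm, smul_mul_assoc, smul_smul, mul_comm s]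

end Multipartition

/-! ### The character of the ideal generated by the Young symmetrizer -/

namespace MonoidAlgebra

variable {G : Type*} [Group G] [Fintype G]

theorem trace_mulLeft_comp_mulRight (σ : G) (x : MonoidAlgebra ℂ G) :
    LinearMap.trace ℂ (MonoidAlgebra ℂ G)
      (LinearMap.mulLeft ℂ (single σ 1) ∘ₗ LinearMap.mulRight ℂ x)
        = ∑ h : G, x.coeff (h⁻¹ * σ⁻¹ * h) := by
  classical
  rw [LinearMap.trace_eq_matrix_trace ℂ (MonoidAlgebra.basis G ℂ), Matrix.trace]
  refine Finset.sum_congr rfl fun h _ => ?_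
  rw [Matrix.diag_apply, LinearMap.toMatrix_apply, MonoidAlgebra.basis_apply]
  change (single σ 1 * (single h 1 * x)).coeff h = _
  rw [MonoidAlgebra.coeff_single_mul_apply, MonoidAlgebra.coeff_single_mul_apply, one_mul,
    one_mul, mul_assoc]

/-- If `e ^ 2 = c • e`, then right multiplication by `e` is `c` times a projection onto the left
ideal generated by `e`, so the character of this ideal is a trace on the whole group algebra. -/
theorem mul_character_span_singleton {e : MonoidAlgebra ℂ G} {c : ℂ} (he : e * e = c • e)
    (σ : G) :
    c * (Representation.ofModule' (k := ℂ) (G := G)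
      (Submodule.span (MonoidAlgebra ℂ G) {e})).character σ
        = ∑ h : G, e.coeff (h⁻¹ * σ⁻¹ * h) := by
  rw [← trace_mulLeft_comp_mulRight]
  set S := Submodule.span (MonoidAlgebra ℂ G) {e} with hS
  have hfin : Module.Finite ℂ (MonoidAlgebra ℂ G) :=
    Module.Finite.of_basis (MonoidAlgebra.basis G ℂ)
  let ι : S →ₗ[ℂ] MonoidAlgebra ℂ G := S.subtype.restrictScalars ℂ
  have hfinS : Module.Finite ℂ S := Module.Finite.of_injective ι S.subtype_injective
  let P : MonoidAlgebra ℂ G →ₗ[ℂ] S :=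
    { toFun := fun x => ⟨x * e, Submodule.mem_span_singleton.2 ⟨x, rfl⟩⟩
      map_add' := fun x y => Subtype.ext (add_mul x y e)
      map_smul' := fun a x => Subtype.ext (smul_mul_assoc a x e) }
  have h1 : (LinearMap.mulLeft ℂ (single σ (1 : ℂ)) ∘ₗ LinearMap.mulRight ℂ e)
      = (LinearMap.mulLeft ℂ (single σ (1 : ℂ)) ∘ₗ ι) ∘ₗ P := rfl
  rw [h1, LinearMap.trace_comp_comm', Representation.character, ← smul_eq_mul, ← map_smul]
  congr 1
  refine LinearMap.ext fun x => Subtype.ext ?_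
  obtain ⟨y, hy⟩ := Submodule.mem_span_singleton.1 x.2
  have hx : (x : MonoidAlgebra ℂ G) * e = c • (x : MonoidAlgebra ℂ G) := by
    rw [← hy, smul_eq_mul, mul_assoc, he, mul_smul_comm]
  have h3 : single σ 1 * (x : MonoidAlgebra ℂ G) * e
      = c • (single σ 1 * (x : MonoidAlgebra ℂ G)) := by
    rw [mul_assoc, hx, mul_smul_comm]
  exact h3.symm

/-- An element whose coefficient at `1` is not zero is not nilpotent: right multiplication by it
does not have trace zero. -/
theorem mul_self_ne_zero_of_coeff_one_ne_zero {e : MonoidAlgebra ℂ G} (he : e.coeff 1 ≠ 0) :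
    e * e ≠ 0 := by
  intro h
  have htr := trace_mulLeft_comp_mulRight (1 : G) e
  have hnil : IsNilpotent (LinearMap.mulLeft ℂ (single (1 : G) (1 : ℂ)) ∘ₗ
      LinearMap.mulRight ℂ e) := by
    refine ⟨2, LinearMap.ext fun x => ?_⟩
    rw [pow_two]
    change single 1 1 * (single 1 1 * (x * e) * e) = 0
    rw [← MonoidAlgebra.one_def, one_mul, one_mul, mul_assoc, h, mul_zero]
  have h0 := (LinearMap.isNilpotent_trace_of_isNilpotent hnil).eq_zero
  rw [htr] at h0
  simp at h0
  exact he h0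

end MonoidAlgebra

namespace Multipartition

variable {k n : ℕ} [NeZero k] (γ : Multipartition k n)

theorem coeff_one_youngSymmetrizer : γ.youngSymmetrizer.coeff 1 = 1 := by
  classical
  have hiff : ∀ (v : Fin n → rootsOfUnity k ℂ), ∀ p ∈ γ.rowPerms, ∀ q ∈ γ.colPerms,
      ((⟨v, p * q⟩ : CyclicWreath k n) = 1 ↔ v = 1 ∧ p = 1 ∧ q = 1) := by
    intro v p hp q hq
    constructor
    · intro h
      have hv : v = 1 := congrArg SemidirectProduct.left h
      have hpq : p * q = 1 := congrArg SemidirectProduct.right h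
      have hp1 : p = 1 := γ.eq_one_of_mem_rowPerms_of_mem_colPerms hp (by
        rw [eq_inv_of_mul_eq_one_left hpq]
        exact γ.inv_mem_colPerms hq)
      refine ⟨hv, hp1, ?_⟩
      rwa [hp1, one_mul] at hpq
    · rintro ⟨rfl, rfl, rfl⟩
      rfl
  rw [youngSymmetrizer]
  simp only [MonoidAlgebra.coeff_sum, Finsupp.coe_finsetSum, Finset.sum_apply,
    MonoidAlgebra.coeff_single, Finsupp.single_apply]
  rw [Finset.sum_eq_single 1, Finset.sum_eq_single 1, Finset.sum_eq_single 1]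
  · rw [if_pos ((hiff _ _ γ.one_mem_rowPerms _ γ.one_mem_colPerms).2 ⟨rfl, rfl, rfl⟩)]
    simp
  · intro q hq hne
    exact if_neg fun h => hne ((hiff _ _ γ.one_mem_rowPerms _ hq).1 h).2.2
  · exact fun h => absurd γ.one_mem_colPerms h
  · intro p hp hne
    exact Finset.sum_eq_zero fun q hq => if_neg fun h => hne ((hiff _ _ hp _ hq).1 h).2.1
  · exact fun h => absurd γ.one_mem_rowPerms h
  · intro v _ hne
    exact Finset.sum_eq_zero fun p hp => Finset.sum_eq_zero fun q hq =>
      if_neg fun h => hne ((hiff _ _ hp _ hq).1 h).1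
  · exact fun h => absurd (Finset.mem_univ _) h

theorem exists_youngSymmetrizer_sq_ne_zero :
    ∃ c : ℂ, c ≠ 0 ∧ γ.youngSymmetrizer * γ.youngSymmetrizer = c • γ.youngSymmetrizer := by
  obtain ⟨c, hc⟩ := γ.exists_youngSymmetrizer_sq
  refine ⟨c, ?_, hc⟩
  rintro rfl
  rw [zero_smul] at hc
  exact MonoidAlgebra.mul_self_ne_zero_of_coeff_one_ne_zero
    (by rw [coeff_one_youngSymmetrizer]; exact one_ne_zero) hc

theorem irrChar_conj (σ τ : CyclicWreath k n) : γ.irrChar (τ * σ * τ⁻¹) = γ.irrChar σ :=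
  Representation.char_conj _ σ τ

end Multipartition

/-- The multiplicity of `χ^γ` in a representation of the wreath product is the rank of the Young
symmetrizer. For the monomial representations to which this is applied, `hφ` is seen from the
formula for the character; it lets the complex conjugation be moved away from `χ^γ`. -/
theorem sum_character_mul_conj_irrChar {k n : ℕ} [NeZero k] (γ : Multipartition k n)
    {V : Type*} [AddCommGroup V] [Module ℂ V] [FiniteDimensional ℂ V]
    (φ : Representation ℂ (CyclicWreath k n) V)
    (hφ : ∀ σ, φ.character σ⁻¹ = starRingEnd ℂ (φ.character σ)) :
    ∑ σ, φ.character σ * starRingEnd ℂ (γ.irrChar σ)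
      = (Fintype.card (CyclicWreath k n) : ℂ)
        * Module.finrank ℂ (LinearMap.range (φ.asAlgebraHom γ.youngSymmetrizer)) := by
  obtain ⟨c, hc, he⟩ := γ.exists_youngSymmetrizer_sq_ne_zero
  have hchar := MonoidAlgebra.mul_character_span_singleton he
  set E := φ.asAlgebraHom γ.youngSymmetrizer with hE
  have hEE : E * E = c • E := by rw [hE, ← map_mul, he, map_smul]
  have hidem : IsIdempotentElem (c⁻¹ • E) := by
    rw [IsIdempotentElem, smul_mul_smul_comm, hEE, smul_smul]
    congr 1
    field_simp
  have hrange : LinearMap.range (c⁻¹ • E) = LinearMap.range E :=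
    LinearMap.range_smul _ _ (inv_ne_zero hc)
  have htr : LinearMap.trace ℂ V E = c * Module.finrank ℂ (LinearMap.range E) := by
    have h := (LinearMap.IsIdempotentElem.isProj_range _ hidem).trace
    rw [hrange, map_smul, smul_eq_mul] at h
    rw [← h, mul_inv_cancel_left₀ hc]
  have htr' : LinearMap.trace ℂ V E
      = ∑ σ, φ.character σ * γ.youngSymmetrizer.coeff σ := by
    rw [hE, Representation.asAlgebraHom_def, MonoidAlgebra.lift_apply, Finsupp.sum_fintype _ _
      (by simp), map_sum]
    exact Finset.sum_congr rfl fun σ _ => by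
      rw [map_smul, smul_eq_mul, mul_comm]; rfl
  have hsum : ∑ σ, φ.character σ⁻¹ * γ.irrChar σ
      = (Fintype.card (CyclicWreath k n) : ℂ) * Module.finrank ℂ (LinearMap.range E) := by
    refine mul_left_cancel₀ hc ?_
    calc c * ∑ σ, φ.character σ⁻¹ * γ.irrChar σ
        = ∑ σ, φ.character σ⁻¹ * ∑ h, γ.youngSymmetrizer.coeff (h⁻¹ * σ⁻¹ * h) := by
          rw [Finset.mul_sum]
          refine Finset.sum_congr rfl fun σ _ => ?_
          rw [← hchar]
          change _ = _ * (c * γ.irrChar σ)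
          ring
      _ = ∑ h, ∑ σ, φ.character (h⁻¹ * σ⁻¹ * h)
            * γ.youngSymmetrizer.coeff (h⁻¹ * σ⁻¹ * h) := by
          simp only [Finset.mul_sum]
          rw [Finset.sum_comm]
          refine Finset.sum_congr rfl fun h _ => Finset.sum_congr rfl fun σ _ => ?_
          congr 1
          have := φ.char_conj σ⁻¹ h⁻¹
          rw [inv_inv] at this
          exact this.symm
      _ = ∑ _h : CyclicWreath k n, LinearMap.trace ℂ V E := by
          refine Finset.sum_congr rfl fun h _ => ?_
          rw [htr']
          refine Fintype.sum_equiv ((Equiv.inv _).trans ((Equiv.mulLeft h⁻¹).trans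
            (Equiv.mulRight h))) _ _ fun σ => rfl
      _ = _ := by
          rw [Finset.sum_const, Finset.card_univ, htr, nsmul_eq_mul]
          ring
  have hconj := congrArg (starRingEnd ℂ) hsum
  rw [map_sum] at hconj
  simp only [map_mul, hφ, Complex.conj_conj, map_natCast] at hconj
  exact hconj

/-! ### Straightening -/

/-- The permutations that fix every index outside `X`. -/
def permsWithin {n : ℕ} (X : Finset (Fin n)) : Finset (Equiv.Perm (Fin n)) :=
  Finset.univ.filter fun w => ∀ i ∉ X, w i = i

theorem mem_permsWithin {n : ℕ} {X : Finset (Fin n)} {w : Equiv.Perm (Fin n)} :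
    w ∈ permsWithin X ↔ ∀ i ∉ X, w i = i := by simp [permsWithin]

theorem apply_mem_of_mem_permsWithin {n : ℕ} {X : Finset (Fin n)} {w : Equiv.Perm (Fin n)}
    (hw : w ∈ permsWithin X) {x : Fin n} (hx : x ∈ X) : w x ∈ X := by
  by_contra h
  have h1 := w.injective (mem_permsWithin.1 hw _ h)
  rw [h1] at h
  exact h hx

theorem sum_mul_comp_perm_eq {ι : Type*} [Fintype ι] (π : Equiv.Perm ι) (f g : ι → ℕ)
    (hf : ∀ i, f (π i) = f i) : ∑ i, f i * g (π i) = ∑ i, f i * g i := by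
  rw [← Equiv.sum_comp π fun i => f i * g i]
  exact Finset.sum_congr rfl fun i _ => by rw [hf]

theorem sum_mul_lt_sum_mul_comp_swap {ι : Type*} [Fintype ι] [DecidableEq ι] {i j : ι}
    (f g : ι → ℕ) (hf : f i < f j) (hg : g j < g i) :
    ∑ x, f x * g x < ∑ x, f x * g (Equiv.swap i j x) := by
  have hij : i ≠ j := fun h => by simp [h] at hf
  have h : ∑ x, (f x : ℤ) * ((g (Equiv.swap i j x) : ℤ) - g x)
      = f i * ((g j : ℤ) - g i) + f j * ((g i : ℤ) - g j) := by
    rw [Fintype.sum_eq_add i j hij]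
    · simp
    · rintro x ⟨hi, hj⟩
      rw [Equiv.swap_apply_of_ne_of_ne hi hj, sub_self, mul_zero]
  have hpos : 0 < (f i : ℤ) * ((g j : ℤ) - g i) + f j * ((g i : ℤ) - g j) := by
    have h1 : (f i : ℤ) < f j := by exact_mod_cast hf
    have h2 : (g j : ℤ) < g i := by exact_mod_cast hg
    nlinarith [mul_pos (sub_pos.2 h1) (sub_pos.2 h2)]
  rw [← h] at hpos
  simp only [mul_sub, Finset.sum_sub_distrib] at hpos
  have h3 := sub_pos.1 hpos
  exact_mod_cast h3

theorem exists_strictMonoOn_nat {C : Type*} [LinearOrder C] (D : Finset C) :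
    ∃ rk : C → ℕ, StrictMonoOn rk D := by
  refine ⟨fun c => (D.filter (· < c)).card, fun a ha b _ hab => Finset.card_lt_card ?_⟩
  refine Finset.ssubset_iff_subset_ne.2 ⟨fun x hx => ?_, fun h => ?_⟩
  · rw [Finset.mem_filter] at hx ⊢
    exact ⟨hx.1, hx.2.trans hab⟩
  · have : a ∈ D.filter (· < a) := by
      rw [h]
      exact Finset.mem_filter.2 ⟨ha, hab⟩
    exact lt_irrefl a (Finset.mem_filter.1 this).2

namespace Multipartition

variable {k n : ℕ} (γ : Multipartition k n) {C : Type*} [LinearOrder C]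

/-- The word `g`, written into the cells of `γ`, increases weakly along the rows and strictly along
the columns. -/
def IsSemistandard (g : Fin n → C) : Prop :=
  (∀ i j, γ.row i = γ.row j → γ.colNum i < γ.colNum j → g i ≤ g j) ∧
    ∀ i j, γ.col i = γ.col j → γ.rowNum i < γ.rowNum j → g i < g j

/-- The image of the word `T` under the signed sum over the column permutations followed by the sum
over the row permutations, as a function on a finite set `O` of words. -/
noncomputable def tabVector (O : Finset (Fin n → C)) (T : Fin n → C) : O → ℂ := fun h =>
  ∑ q ∈ γ.colPerms, ∑ p ∈ γ.rowPerms,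
    ((Equiv.Perm.sign q : ℤ) : ℂ) * if T ∘ q ∘ p = h.1 then 1 else 0

variable (O : Finset (Fin n → C))

theorem tabVector_comp_colPerm (T : Fin n → C) {q : Equiv.Perm (Fin n)} (hq : q ∈ γ.colPerms) :
    γ.tabVector O (T ∘ q) = ((Equiv.Perm.sign q : ℤ) : ℂ) • γ.tabVector O T := by
  ext h
  rw [Pi.smul_apply, smul_eq_mul, tabVector, tabVector, Finset.mul_sum]
  refine Finset.sum_bij' (fun x _ => q * x) (fun x _ => q⁻¹ * x)
    (fun x hx => γ.mul_mem_colPerms hq hx)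
    (fun x hx => γ.mul_mem_colPerms (γ.inv_mem_colPerms hq) hx) ?_ ?_ ?_
  · intro x _; group
  · intro x _; group
  · intro x _
    rw [Finset.mul_sum]
    refine Finset.sum_congr rfl fun p _ => ?_
    rw [← mul_assoc, Equiv.Perm.sign_mul, Equiv.Perm.coe_mul, Function.comp_assoc,
      Function.comp_assoc]
    congr 1
    rcases Int.units_eq_one_or (Equiv.Perm.sign q) with h | h <;> simp [h]

/-- The Garnir relation: a set `X` of indices such that every column permutation leaves two of its
elements in one row gives a relation between the vectors of the words obtained by permuting
`X`. -/
theorem sum_sign_smul_tabVector_eq_zero (T : Fin n → C) (X : Finset (Fin n))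
    (hX : ∀ q ∈ γ.colPerms, ∃ x ∈ X, ∃ y ∈ X, x ≠ y ∧ γ.row (q⁻¹ x) = γ.row (q⁻¹ y)) :
    ∑ w ∈ permsWithin X, ((Equiv.Perm.sign w : ℤ) : ℂ) • γ.tabVector O (T ∘ w) = 0 := by
  ext h
  rw [Finset.sum_apply, Pi.zero_apply]
  simp only [Pi.smul_apply, smul_eq_mul, tabVector, Finset.mul_sum]
  rw [Finset.sum_comm]
  refine Finset.sum_eq_zero fun q hq => ?_
  rw [Finset.sum_comm]
  obtain ⟨x, hx, y, hy, hxy, hrow⟩ := hX q hq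
  -- the transposition `(x y)` on the left of `q` is a row permutation on the right of `q`
  have ht : ∀ p : Equiv.Perm (Fin n),
      Equiv.swap x y * (q * (Equiv.swap (q⁻¹ x) (q⁻¹ y) * p)) = q * p := by
    intro p
    rw [Equiv.swap_apply_apply, inv_inv]
    have := Equiv.swap_mul_self x y
    calc _ = (Equiv.swap x y * Equiv.swap x y) * (q * p) := by group
      _ = q * p := by rw [this, one_mul]
  have hself : ∀ F : Equiv.Perm (Fin n) → Equiv.Perm (Fin n) → ℂ,
      (∀ w p, F (w * Equiv.swap x y) (Equiv.swap (q⁻¹ x) (q⁻¹ y) * p) = -F w p) →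
      ∑ p ∈ γ.rowPerms, ∑ w ∈ permsWithin X, F w p = 0 := by
    intro F hF
    have hs := γ.swap_mem_rowPerms hrow
    have hw : ∀ w ∈ permsWithin X, w * Equiv.swap x y ∈ permsWithin X := by
      intro w hw
      refine mem_permsWithin.2 fun i hi => ?_
      rw [Equiv.Perm.mul_apply, Equiv.swap_apply_of_ne_of_ne (ne_of_mem_of_not_mem hx hi).symm
        (ne_of_mem_of_not_mem hy hi).symm, mem_permsWithin.1 hw i hi]
    have hneg : ∑ p ∈ γ.rowPerms, ∑ w ∈ permsWithin X, F w p
        = ∑ p ∈ γ.rowPerms, ∑ w ∈ permsWithin X, -F w p := by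
      symm
      refine Finset.sum_bij' (fun p _ => Equiv.swap (q⁻¹ x) (q⁻¹ y) * p)
        (fun p _ => Equiv.swap (q⁻¹ x) (q⁻¹ y) * p)
        (fun p hp => γ.mul_mem_rowPerms hs hp) (fun p hp => γ.mul_mem_rowPerms hs hp)
        (fun p _ => Equiv.swap_mul_self_mul _ _ _) (fun p _ => Equiv.swap_mul_self_mul _ _ _) ?_
      intro p _
      refine Finset.sum_bij' (fun w _ => w * Equiv.swap x y) (fun w _ => w * Equiv.swap x y)
        hw hw (fun w _ => Equiv.mul_swap_mul_self _ _ _)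
        (fun w _ => Equiv.mul_swap_mul_self _ _ _) ?_
      intro w _
      rw [hF]
    simp only [Finset.sum_neg_distrib] at hneg
    exact self_eq_neg.1 hneg
  refine hself (fun w p => ((Equiv.Perm.sign w : ℤ) : ℂ) * (((Equiv.Perm.sign q : ℤ) : ℂ) *
    if (T ∘ w) ∘ q ∘ p = h.1 then 1 else 0)) fun w p => ?_
  have hword : (T ∘ ⇑(w * Equiv.swap x y)) ∘ q ∘ ⇑(Equiv.swap (q⁻¹ x) (q⁻¹ y) * p)
      = (T ∘ w) ∘ q ∘ p := by
    have := congrArg (fun σ : Equiv.Perm (Fin n) => T ∘ w ∘ ⇑σ) (ht p)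
    simpa only [Equiv.Perm.coe_mul, Function.comp_assoc] using this
  rw [hword, Equiv.Perm.sign_mul, Equiv.Perm.sign_swap hxy]
  simp only [mul_neg, mul_one, Units.val_neg, Int.cast_neg, neg_mul]

/-- The pigeonhole principle behind the Garnir relation: the part of a column from some row on and
the part of a later column up to this row have together more cells than the first column. -/
theorem exists_row_eq_of_garnir {i j : Fin n} (hrow : γ.row i = γ.row j)
    (hcol : γ.colNum i < γ.colNum j) {q : Equiv.Perm (Fin n)} (hq : q ∈ γ.colPerms) :
    ∃ x ∈ Finset.univ.filter (fun x => γ.col x = γ.col i ∧ γ.rowNum i ≤ γ.rowNum x) ∪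
        Finset.univ.filter (fun x => γ.col x = γ.col j ∧ γ.rowNum x ≤ γ.rowNum i),
      ∃ y ∈ Finset.univ.filter (fun x => γ.col x = γ.col i ∧ γ.rowNum i ≤ γ.rowNum x) ∪
        Finset.univ.filter (fun x => γ.col x = γ.col j ∧ γ.rowNum x ≤ γ.rowNum i),
      x ≠ y ∧ γ.row (q⁻¹ x) = γ.row (q⁻¹ y) := by
  classical
  set A := Finset.univ.filter (fun x => γ.col x = γ.col i ∧ γ.rowNum i ≤ γ.rowNum x) with hA
  set B := Finset.univ.filter (fun x => γ.col x = γ.col j ∧ γ.rowNum x ≤ γ.rowNum i) with hB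
  set A' := Finset.univ.filter (fun x => γ.col x = γ.col i ∧ γ.rowNum x < γ.rowNum i) with hA'
  set K := Finset.univ.filter (fun x => γ.col x = γ.col i) with hK
  have hcomp : γ.comp i = γ.comp j := (γ.row_eq_iff.1 hrow).1
  have hr : γ.rowNum i = γ.rowNum j := (γ.row_eq_iff.1 hrow).2
  have hAB : Disjoint A B := by
    rw [Finset.disjoint_left]
    intro x hxA hxB
    rw [hA, Finset.mem_filter] at hxA
    rw [hB, Finset.mem_filter] at hxB
    have := (γ.col_eq_iff.1 (hxA.2.1.symm.trans hxB.2.1)).2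
    omega
  have hKcard : K.card = A.card + A'.card := by
    rw [← Finset.card_union_of_disjoint]
    · congr 1
      ext x
      simp only [hK, hA, hA', Finset.mem_union, Finset.mem_filter, Finset.mem_univ, true_and]
      have := le_or_gt (γ.rowNum i) (γ.rowNum x)
      tauto
    · rw [Finset.disjoint_left]
      intro x hx hx'
      rw [hA, Finset.mem_filter] at hx
      rw [hA', Finset.mem_filter] at hx'
      omega
  have hA'card : A'.card ≤ γ.rowNum i := by
    rw [← Finset.card_range (γ.rowNum i)]
    refine Finset.card_le_card_of_injOn γ.rowNum (fun x hx => ?_) fun x hx y hy hxy => ?_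
    · rw [hA', Finset.mem_coe, Finset.mem_filter] at hx
      exact Finset.mem_coe.2 (Finset.mem_range.2 hx.2.2)
    · rw [hA', Finset.mem_coe, Finset.mem_filter] at hx hy
      have := γ.col_eq_iff.1 (hx.2.1.trans hy.2.1.symm)
      exact γ.index_ext this.1 hxy this.2
  have hBcard : γ.rowNum i + 1 ≤ B.card := by
    have hsub : Finset.range (γ.rowNum i + 1) ⊆ B.image γ.rowNum := by
      intro r hr'
      rw [Finset.mem_range] at hr'
      have hmem : (r, γ.colNum j) ∈ γ.shape (γ.comp j) :=
        YoungDiagram.up_left_mem _ (by omega : r ≤ γ.rowNum j) le_rfl (γ.rowNum_colNum_mem j)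
      obtain ⟨x, hx, hxr, hxc⟩ := γ.exists_index hmem
      refine Finset.mem_image.2 ⟨x, ?_, hxr⟩
      rw [hB, Finset.mem_filter]
      exact ⟨Finset.mem_univ _, γ.col_eq_iff.2 ⟨hx, hxc⟩, by omega⟩
    calc γ.rowNum i + 1 = (Finset.range (γ.rowNum i + 1)).card := (Finset.card_range _).symm
      _ ≤ (B.image γ.rowNum).card := Finset.card_le_card hsub
      _ ≤ B.card := Finset.card_image_le
  have hqinv : ∀ x, γ.col (q⁻¹ x) = γ.col x := γ.mem_colPerms.1 (γ.inv_mem_colPerms hq)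
  have hmaps : ∀ x ∈ A ∪ B, γ.rowNum (q⁻¹ x) ∈ K.image γ.rowNum := by
    intro x hx
    have hcx := γ.col_eq_iff.1 (hqinv x)
    have hmem := γ.rowNum_colNum_mem (q⁻¹ x)
    have hmem' : (γ.rowNum (q⁻¹ x), γ.colNum i) ∈ γ.shape (γ.comp i) := by
      rcases Finset.mem_union.1 hx with h | h
      · rw [hA, Finset.mem_filter] at h
        have hxi := γ.col_eq_iff.1 h.2.1
        rwa [hcx.1, hcx.2, hxi.1, hxi.2] at hmem
      · rw [hB, Finset.mem_filter] at h
        have hxj := γ.col_eq_iff.1 h.2.1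
        rw [hcx.1, hcx.2, hxj.1, hxj.2, ← hcomp] at hmem
        exact YoungDiagram.up_left_mem _ le_rfl hcol.le hmem
    obtain ⟨y, hy, hyr, hyc⟩ := γ.exists_index hmem'
    refine Finset.mem_image.2 ⟨y, ?_, hyr⟩
    rw [hK, Finset.mem_filter]
    exact ⟨Finset.mem_univ _, γ.col_eq_iff.2 ⟨hy, hyc⟩⟩
  have hcard : (K.image γ.rowNum).card < (A ∪ B).card := by
    rw [Finset.card_union_of_disjoint hAB]
    have := Finset.card_image_le (s := K) (f := γ.rowNum)
    omega
  obtain ⟨x, hx, y, hy, hxy, he⟩ := Finset.exists_ne_map_eq_of_card_lt_of_maps_to hcard hmaps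
  have hcompX : ∀ x ∈ A ∪ B, γ.comp (q⁻¹ x) = γ.comp i := by
    intro x hx
    rw [(γ.col_eq_iff.1 (hqinv x)).1]
    rcases Finset.mem_union.1 hx with h | h
    · rw [hA, Finset.mem_filter] at h
      exact (γ.col_eq_iff.1 h.2.1).1
    · rw [hB, Finset.mem_filter] at h
      rw [(γ.col_eq_iff.1 h.2.1).1, hcomp]
  exact ⟨x, hx, y, hy, hxy, γ.row_eq_iff.2 ⟨by rw [hcompX x hx, hcompX y hy], he⟩⟩

end Multipartition

namespace Multipartition

variable {k n : ℕ} (γ : Multipartition k n) {C : Type*} [LinearOrder C]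
  (O : Finset (Fin n → C))

/-- Permuting the part `A` of a column and the part `B` of a later column, where all values on `A`
exceed all values on `B`, moves large values into the later column, unless `B` is mapped to
itself. -/
theorem sum_colNum_mul_lt {A B : Finset (Fin n)} {c d : ℕ} (hcd : c < d)
    (hA : ∀ x ∈ A, γ.colNum x = c) (hB : ∀ x ∈ B, γ.colNum x = d) (f : Fin n → ℕ) (m : ℕ)
    (hfA : ∀ x ∈ A, m ≤ f x) (hfB : ∀ x ∈ B, f x < m) {w : Equiv.Perm (Fin n)}
    (hw : w ∈ permsWithin (A ∪ B)) (hwB : B.image w ≠ B) :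
    ∑ x, γ.colNum x * f x < ∑ x, γ.colNum x * f (w x) := by
  classical
  let base : Fin n → ℕ := fun x => if x ∈ B then c else γ.colNum x
  have hsplit : ∀ x, γ.colNum x = base x + (d - c) * if x ∈ B then 1 else 0 := by
    intro x
    by_cases hx : x ∈ B
    · simp only [base, if_pos hx, hB x hx]
      omega
    · simp [base, if_neg hx]
  have hbaseX : ∀ x ∈ A ∪ B, base x = c := by
    intro x hx
    by_cases hxB : x ∈ B
    · simp [base, hxB]
    · simpa [base, hxB] using hA x ((Finset.mem_union.1 hx).resolve_right hxB)
  have hbase : ∀ x, base (w x) = base x := by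
    intro x
    by_cases hx : x ∈ A ∪ B
    · rw [hbaseX x hx, hbaseX _ (apply_mem_of_mem_permsWithin hw hx)]
    · rw [mem_permsWithin.1 hw x hx]
  have hsum : ∀ g : Fin n → ℕ,
      ∑ x, γ.colNum x * g x = ∑ x, base x * g x + (d - c) * ∑ x ∈ B, g x := by
    intro g
    rw [← Finset.sum_filter_add_sum_filter_not Finset.univ (· ∈ B) fun x => γ.colNum x * g x]
    rw [← Finset.sum_filter_add_sum_filter_not Finset.univ (· ∈ B) fun x => base x * g x]
    have hf : Finset.univ.filter (· ∈ B) = B := by ext; simp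
    rw [hf, Finset.mul_sum, add_right_comm, ← Finset.sum_add_distrib]
    congr 1
    · refine Finset.sum_congr rfl fun x hx => ?_
      rw [hsplit x, if_pos hx]
      ring
    · refine Finset.sum_congr rfl fun x hx => ?_
      rw [hsplit x, if_neg (Finset.mem_filter.1 hx).2]
      ring
  rw [hsum, hsum, sum_mul_comp_perm_eq w base f hbase]
  refine Nat.add_lt_add_left (Nat.mul_lt_mul_of_pos_left ?_ (by omega)) _
  rw [← Finset.sum_image (f := f) (fun x _ y _ h => w.injective h)]
  refine Finset.sum_lt_sum_of_exchange ?_ hwB.symm m ?_ ?_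
  · rw [Finset.card_image_of_injective _ w.injective]
  · intro x hx
    rw [Finset.mem_sdiff, Finset.mem_image] at hx
    obtain ⟨⟨y, hy, rfl⟩, hxB⟩ := hx
    have := apply_mem_of_mem_permsWithin hw (Finset.mem_union_right A hy)
    exact hfA _ ((Finset.mem_union.1 this).resolve_right hxB)
  · intro x hx
    exact hfB x (Finset.mem_sdiff.1 hx).1

/-- Straightening: the vectors of the semistandard words span the vectors of all words. In a word
that is maximal, for the pair of weights below, among those that violate this, two cells of a
column in the wrong order can be exchanged; and a descent in a row can be removed by the Garnir
relation. Both steps lead to larger words. -/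
theorem tabVector_mem_span (hO : ∀ g ∈ O, ∀ π : Equiv.Perm (Fin n), g ∘ π ∈ O)
    (Q : Fin k → C → Prop) {T : Fin n → C} (hT : T ∈ O) (hTQ : ∀ i, Q (γ.comp i) (T i)) :
    γ.tabVector O T ∈ Submodule.span ℂ (γ.tabVector O ''
      {S | S ∈ O ∧ (∀ i, Q (γ.comp i) (S i)) ∧ γ.IsSemistandard S}) := by
  classical
  set V := Submodule.span ℂ (γ.tabVector O ''
      {S | S ∈ O ∧ (∀ i, Q (γ.comp i) (S i)) ∧ γ.IsSemistandard S}) with hV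
  by_contra hbad
  obtain ⟨rk, hrk⟩ := exists_strictMonoOn_nat (O.biUnion fun g => Finset.univ.image g)
  have hmem : ∀ g ∈ O, ∀ i, g i ∈ ((O.biUnion fun g => Finset.univ.image g : Finset C) : Set C) :=
    fun g hg i => Finset.mem_coe.2
      (Finset.mem_biUnion.2 ⟨g, hg, Finset.mem_image_of_mem g (Finset.mem_univ i)⟩)
  let key : (Fin n → C) → ℕ ×ₗ ℕ := fun g =>
    toLex (∑ x, γ.colNum x * rk (g x), ∑ x, γ.rowNum x * rk (g x))
  let bad := O.filter fun g => (∀ i, Q (γ.comp i) (g i)) ∧ γ.tabVector O g ∉ V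
  obtain ⟨T, hTbad, hmax⟩ := Finset.exists_max_image bad key
    ⟨T, Finset.mem_filter.2 ⟨hT, hTQ, hbad⟩⟩
  obtain ⟨hTO, hTQ, hTV⟩ := Finset.mem_filter.1 hTbad
  -- larger words with the same components are in the span
  have hgood : ∀ w : Equiv.Perm (Fin n), (∀ i, γ.comp (w i) = γ.comp i) →
      key T < key (T ∘ w) → γ.tabVector O (T ∘ w) ∈ V := by
    intro w hw hlt
    by_contra h
    refine absurd (hmax (T ∘ w) (Finset.mem_filter.2 ⟨hO T hTO w, fun i => ?_, h⟩))
      (not_le.2 hlt)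
    rw [← hw]
    exact hTQ (w i)
  have hcolstrict : ∀ i j, γ.col i = γ.col j → γ.rowNum i < γ.rowNum j → T i < T j := by
    intro i j hij hlt
    by_contra hcon
    have hne : i ≠ j := fun h => by simp [h] at hlt
    have hs := γ.swap_mem_colPerms hij
    have hD := γ.tabVector_comp_colPerm O T hs
    rw [Equiv.Perm.sign_swap hne] at hD
    rcases (not_lt.1 hcon).eq_or_lt with he | hl
    · have hTs : T ∘ Equiv.swap i j = T := by
        ext x
        rw [Function.comp_apply, Equiv.swap_apply_def]
        split_ifs with h1 h2
        · rw [h1, he]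
        · rw [h2, he]
        · rfl
      rw [hTs] at hD
      have h0 : γ.tabVector O T = 0 := by
        simp only [Units.val_neg, Units.val_one, Int.cast_neg, Int.cast_one, neg_smul,
          one_smul] at hD
        exact self_eq_neg.1 hD
      exact hTV (h0 ▸ V.zero_mem)
    · have hin := hgood _ (γ.comp_of_mem_colPerms hs) (by
        refine Prod.Lex.toLex_lt_toLex.2 (Or.inr ⟨?_, ?_⟩)
        · exact (sum_mul_comp_perm_eq (Equiv.swap i j) γ.colNum (fun x => rk (T x)) fun x =>
            (γ.col_eq_iff.1 (γ.mem_colPerms.1 hs x)).2).symm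
        · exact sum_mul_lt_sum_mul_comp_swap γ.rowNum (fun x => rk (T x)) hlt
            (hrk (hmem T hTO j) (hmem T hTO i) hl))
      rw [hD] at hin
      simp only [Units.val_neg, Units.val_one, Int.cast_neg, Int.cast_one, neg_smul,
        one_smul, Submodule.neg_mem_iff] at hin
      exact hTV hin
  have hcolle : ∀ i j, γ.col i = γ.col j → γ.rowNum i ≤ γ.rowNum j → T i ≤ T j := by
    intro i j hij hle
    rcases hle.eq_or_lt with he | hl
    · rw [γ.index_ext (γ.col_eq_iff.1 hij).1 he (γ.col_eq_iff.1 hij).2]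
    · exact (hcolstrict i j hij hl).le
  refine hTV (Submodule.subset_span ⟨T, ⟨hTO, hTQ, ?_, hcolstrict⟩, rfl⟩)
  intro i j hrow hcol
  by_contra hcon
  have hji : T j < T i := not_le.1 hcon
  set A := Finset.univ.filter (fun x => γ.col x = γ.col i ∧ γ.rowNum i ≤ γ.rowNum x) with hA
  set B := Finset.univ.filter (fun x => γ.col x = γ.col j ∧ γ.rowNum x ≤ γ.rowNum i) with hB
  have hr : γ.rowNum i = γ.rowNum j := (γ.row_eq_iff.1 hrow).2
  have hAcol : ∀ x ∈ A, γ.col x = γ.col i := fun x hx => (Finset.mem_filter.1 hx).2.1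
  have hBcol : ∀ x ∈ B, γ.col x = γ.col j := fun x hx => (Finset.mem_filter.1 hx).2.1
  have hgarnir := γ.sum_sign_smul_tabVector_eq_zero O T (A ∪ B)
    fun q hq => γ.exists_row_eq_of_garnir hrow hcol hq
  have hcompX : ∀ x ∈ A ∪ B, γ.comp x = γ.comp i := by
    intro x hx
    rcases Finset.mem_union.1 hx with h | h
    · exact (γ.col_eq_iff.1 (hAcol x h)).1
    · rw [(γ.col_eq_iff.1 (hBcol x h)).1, (γ.row_eq_iff.1 hrow).1]
  have hcompw : ∀ w ∈ permsWithin (A ∪ B), ∀ x, γ.comp (w x) = γ.comp x := by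
    intro w hw x
    by_cases hx : x ∈ A ∪ B
    · rw [hcompX x hx, hcompX _ (apply_mem_of_mem_permsWithin hw hx)]
    · rw [mem_permsWithin.1 hw x hx]
  -- the permutations that preserve `B` contribute multiples of the vector of `T`
  have hpres : ∀ w ∈ permsWithin (A ∪ B), B.image w = B → w ∈ γ.colPerms := by
    intro w hw hwB
    refine γ.mem_colPerms.2 fun x => ?_
    by_cases hxB : x ∈ B
    · rw [hBcol x hxB, hBcol (w x) (hwB ▸ Finset.mem_image_of_mem w hxB)]
    · by_cases hxA : x ∈ A
      · have h1 := apply_mem_of_mem_permsWithin hw (Finset.mem_union_left B hxA)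
        have h2 : w x ∉ B := by
          intro h
          rw [← hwB] at h
          obtain ⟨y, hy, hyx⟩ := Finset.mem_image.1 h
          rw [w.injective hyx] at hy
          exact hxB hy
        rw [hAcol x hxA, hAcol _ ((Finset.mem_union.1 h1).resolve_right h2)]
      · rw [mem_permsWithin.1 hw x (by simp [hxA, hxB])]
  rw [← Finset.sum_filter_add_sum_filter_not _ fun w : Equiv.Perm (Fin n) => B.image w = B]
    at hgarnir
  have hfirst : ∑ w ∈ (permsWithin (A ∪ B)).filter (fun w : Equiv.Perm (Fin n) => B.image w = B),
      ((Equiv.Perm.sign w : ℤ) : ℂ) • γ.tabVector O (T ∘ w)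
      = (((permsWithin (A ∪ B)).filter (fun w : Equiv.Perm (Fin n) => B.image w = B)).card : ℂ)
        • γ.tabVector O T := by
    rw [Nat.cast_smul_eq_nsmul, ← Finset.sum_const]
    refine Finset.sum_congr rfl fun w hw => ?_
    rw [Finset.mem_filter] at hw
    rw [γ.tabVector_comp_colPerm O T (hpres w hw.1 hw.2), smul_smul]
    rcases Int.units_eq_one_or (Equiv.Perm.sign w) with h | h <;> simp [h]
  have hsecond : ∑ w ∈ (permsWithin (A ∪ B)).filter (fun w : Equiv.Perm (Fin n) => ¬ B.image w = B),
      ((Equiv.Perm.sign w : ℤ) : ℂ) • γ.tabVector O (T ∘ w) ∈ V := by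
    refine Submodule.sum_mem _ fun w hw => Submodule.smul_mem _ _ ?_
    rw [Finset.mem_filter] at hw
    refine hgood w (hcompw w hw.1) (Prod.Lex.toLex_lt_toLex.2 (Or.inl ?_))
    refine γ.sum_colNum_mul_lt hcol (fun x hx => (γ.col_eq_iff.1 (hAcol x hx)).2)
      (fun x hx => (γ.col_eq_iff.1 (hBcol x hx)).2) (fun x => rk (T x)) (rk (T i)) ?_ ?_ hw.1 hw.2
    · intro x hx
      exact (hrk.le_iff_le (hmem T hTO i) (hmem T hTO x)).2
        (hcolle i x (hAcol x hx).symm (Finset.mem_filter.1 hx).2.2)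
    · intro x hx
      refine hrk (hmem T hTO x) (hmem T hTO i) (lt_of_le_of_lt ?_ hji)
      exact hcolle x j (hBcol x hx) (hr ▸ (Finset.mem_filter.1 hx).2.2)
  have hone : (1 : Equiv.Perm (Fin n)) ∈
      (permsWithin (A ∪ B)).filter (fun w : Equiv.Perm (Fin n) => B.image w = B) := by
    rw [Finset.mem_filter]
    exact ⟨mem_permsWithin.2 fun _ _ => rfl, by simp⟩
  have hcard : (((permsWithin (A ∪ B)).filter (fun w : Equiv.Perm (Fin n) => B.image w = B)).card : ℂ) ≠ 0 :=
    Nat.cast_ne_zero.2 (Finset.card_pos.2 ⟨1, hone⟩).ne'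
  rw [hfirst] at hgarnir
  have hin : (((permsWithin (A ∪ B)).filter (fun w : Equiv.Perm (Fin n) => B.image w = B)).card : ℂ)
      • γ.tabVector O T ∈ V := by
    rw [eq_neg_of_add_eq_zero_left hgarnir]
    exact V.neg_mem hsecond
  exact hTV ((V.smul_mem_iff hcard).1 hin)

/-! ### Independence of the vectors of semistandard words -/

/-- Two words that increase weakly along the rows and have the same contents of the rows are
equal: there are fewer small values in a row of the word with the larger entry. -/
theorem eq_of_comp_rowPerm {S T : Fin n → C}
    (hS : ∀ i j, γ.row i = γ.row j → γ.colNum i < γ.colNum j → S i ≤ S j)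
    (hT : ∀ i j, γ.row i = γ.row j → γ.colNum i < γ.colNum j → T i ≤ T j)
    {p : Equiv.Perm (Fin n)} (hp : p ∈ γ.rowPerms) (h : S = T ∘ p) : S = T := by
  classical
  have key : ∀ (U W : Fin n → C) (r : Equiv.Perm (Fin n)), r ∈ γ.rowPerms → U = W ∘ r →
      (∀ i j, γ.row i = γ.row j → γ.colNum i < γ.colNum j → U i ≤ U j) →
      (∀ i j, γ.row i = γ.row j → γ.colNum i < γ.colNum j → W i ≤ W j) →
      ∀ i, ¬ U i < W i := by
    intro U W r hr hUW hU hW i hlt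
    have hcard : (Finset.univ.filter fun j => γ.row j = γ.row i ∧ U j ≤ U i).card
        = (Finset.univ.filter fun j => γ.row j = γ.row i ∧ W j ≤ U i).card := by
      refine Finset.card_bij' (fun j _ => r j) (fun j _ => r⁻¹ j) ?_ ?_ ?_ ?_
      · intro j hj
        simp only [Finset.mem_filter, Finset.mem_univ, true_and] at hj ⊢
        rw [γ.mem_rowPerms.1 hr]
        exact ⟨hj.1, by rw [hUW] at hj ⊢; exact hj.2⟩
      · intro j hj
        simp only [Finset.mem_filter, Finset.mem_univ, true_and] at hj ⊢
        rw [γ.mem_rowPerms.1 (γ.inv_mem_rowPerms hr)]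
        refine ⟨hj.1, ?_⟩
        have : U (r⁻¹ j) = W j := by rw [hUW]; simp
        rw [this]
        exact hj.2
      · intro j _; simp
      · intro j _; simp
    have hsub : (Finset.univ.filter fun j => γ.row j = γ.row i ∧ W j ≤ U i)
        ⊂ Finset.univ.filter fun j => γ.row j = γ.row i ∧ U j ≤ U i := by
      rw [Finset.ssubset_iff_of_subset]
      · exact ⟨i, by simp, by simpa using hlt⟩
      · intro j hj
        simp only [Finset.mem_filter, Finset.mem_univ, true_and] at hj ⊢
        refine ⟨hj.1, ?_⟩
        have hlt' : W j < W i := lt_of_le_of_lt hj.2 hlt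
        rcases lt_trichotomy (γ.colNum j) (γ.colNum i) with hc | hc | hc
        · exact hU j i hj.1 hc
        · have hr := γ.row_eq_iff.1 hj.1
          rw [γ.index_ext hr.1 hr.2 hc]
        · exact absurd hlt' (not_lt.2 (hW i j hj.1.symm hc))
    exact absurd hcard (Finset.card_lt_card hsub).ne'
  ext i
  refine le_antisymm (not_lt.1 ?_) (not_lt.1 (key S T p hp h hS hT i))
  refine key T S p⁻¹ (γ.inv_mem_rowPerms hp) ?_ hT hS i
  ext x
  simp [h]

/-- The matrix of the vectors of the semistandard words is triangular for the weight
`∑ rowNum * rk`, since sorting a column increases this weight. -/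
theorem linearIndependent_tabVector :
    LinearIndependent ℂ fun T : {S : Fin n → C // S ∈ O ∧ γ.IsSemistandard S} =>
      γ.tabVector O T.1 := by
  classical
  obtain ⟨rk, hrk⟩ := exists_strictMonoOn_nat (O.biUnion fun g => Finset.univ.image g)
  have hmem : ∀ g ∈ O, ∀ i, g i ∈ ((O.biUnion fun g => Finset.univ.image g : Finset C) : Set C) :=
    fun g hg i => Finset.mem_coe.2
      (Finset.mem_biUnion.2 ⟨g, hg, Finset.mem_image_of_mem g (Finset.mem_univ i)⟩)
  let wt : (Fin n → C) → ℕ := fun g => ∑ x, γ.rowNum x * rk (g x)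
  have hrowinv : ∀ (g : Fin n → C), ∀ p ∈ γ.rowPerms, wt (g ∘ p) = wt g := fun g p hp =>
    sum_mul_comp_perm_eq p γ.rowNum (fun x => rk (g x)) fun x =>
      (γ.row_eq_iff.1 (γ.mem_rowPerms.1 hp x)).2
  have hcolone : ∀ T ∈ O, γ.IsSemistandard T → ∀ q ∈ γ.colPerms, wt T ≤ wt (T ∘ q) → q = 1 := by
    intro T hT hTs q hq hle
    refine eq_one_of_sum_le_sum_mul_comp_perm γ.col q (γ.mem_colPerms.1 hq) γ.rowNum
      (fun x => rk (T x)) ?_ ?_ hle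
    · intro i j hij hr
      exact γ.index_ext (γ.col_eq_iff.1 hij).1 hr (γ.col_eq_iff.1 hij).2
    · intro i j hij hr
      exact hrk (hmem T hT i) (hmem T hT j) (hTs.2 i j hij hr)
  have htri : ∀ T ∈ O, γ.IsSemistandard T → ∀ S (hS : S ∈ O), γ.IsSemistandard S →
      wt T ≤ wt S → T ≠ S → γ.tabVector O T ⟨S, hS⟩ = 0 := by
    intro T hT hTs S hS hSs hle hne
    refine Finset.sum_eq_zero fun q hq => Finset.sum_eq_zero fun p hp => ?_
    rw [if_neg, mul_zero]
    intro (hw : T ∘ q ∘ p = S)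
    have hq1 : q = 1 := by
      refine hcolone T hT hTs q hq ?_
      rw [← hrowinv (T ∘ q) p hp, Function.comp_assoc, hw]
      exact hle
    subst hq1
    exact hne (γ.eq_of_comp_rowPerm hSs.1 hTs.1 hp hw.symm).symm
  have hdiag : ∀ T (hT : T ∈ O), γ.IsSemistandard T → γ.tabVector O T ⟨T, hT⟩ ≠ 0 := by
    intro T hT hTs
    have h1 : γ.tabVector O T ⟨T, hT⟩
        = ∑ p ∈ γ.rowPerms, if T ∘ p = T then (1 : ℂ) else 0 := by
      rw [tabVector, Finset.sum_eq_single 1]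
      · simp
      · intro q hq hne
        refine Finset.sum_eq_zero fun p hp => ?_
        rw [if_neg, mul_zero]
        intro (hw : T ∘ q ∘ p = T)
        refine hne (hcolone T hT hTs q hq ?_)
        rw [← hrowinv (T ∘ q) p hp, Function.comp_assoc, hw]
      · exact fun h => absurd γ.one_mem_colPerms h
    rw [h1, Finset.sum_boole, Nat.cast_ne_zero]
    have hone : (1 : Equiv.Perm (Fin n)) ∈
        γ.rowPerms.filter fun p : Equiv.Perm (Fin n) => T ∘ p = T :=
      Finset.mem_filter.2 ⟨γ.one_mem_rowPerms, rfl⟩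
    exact (Finset.card_pos.2 ⟨1, hone⟩).ne'
  rw [linearIndependent_iff']
  intro s a ha T hTs
  by_contra hne
  -- evaluate at a word of largest weight among those with nonzero coefficient
  obtain ⟨S, hS, hmax⟩ := Finset.exists_max_image (s.filter fun T => a T ≠ 0) (fun T => wt T.1)
    ⟨T, Finset.mem_filter.2 ⟨hTs, hne⟩⟩
  rw [Finset.mem_filter] at hS
  have hval := congrFun ha ⟨S.1, S.2.1⟩
  rw [Finset.sum_apply, Finset.sum_eq_single S] at hval
  · exact mul_ne_zero hS.2 (hdiag S.1 S.2.1 S.2.2) hval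
  · intro U hU hUS
    rw [Pi.smul_apply, smul_eq_mul]
    by_cases hU0 : a U = 0
    · rw [hU0, zero_mul]
    · rw [htri U.1 U.2.1 U.2.2 S.1 S.2.1 S.2.2 (hmax U (Finset.mem_filter.2 ⟨hU, hU0⟩))
        (fun h => hUS (Subtype.ext h)), mul_zero]
  · exact fun h => absurd hS.1 h

end Multipartition

/-! ### The monomial representation on words -/

theorem sum_rootsOfUnity_zpow {k : ℕ} [NeZero k] (m : ℤ) :
    ∑ u : rootsOfUnity k ℂ, ((u : ℂˣ) : ℂ) ^ m
      = if (k : ℤ) ∣ m then (Fintype.card (rootsOfUnity k ℂ) : ℂ) else 0 := by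
  split_ifs with h
  · obtain ⟨d, rfl⟩ := h
    have h1 : ∀ u : rootsOfUnity k ℂ, ((u : ℂˣ) : ℂ) ^ ((k : ℤ) * d) = 1 := by
      intro u
      have hu : (u : ℂˣ) ^ k = 1 := (mem_rootsOfUnity k _).1 u.2
      rw [zpow_mul, zpow_natCast, ← Units.val_pow_eq_pow_val, hu, Units.val_one, one_zpow]
    rw [Finset.sum_congr rfl fun u _ => h1 u]
    simp
  · have hprim := Complex.isPrimitiveRoot_exp k (NeZero.ne k)
    let u₀ : rootsOfUnity k ℂ := hprim.toRootsOfUnity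
    have hu₀ : ((u₀ : ℂˣ) : ℂ) ^ m ≠ 1 := fun h1 => h ((hprim.zpow_eq_one_iff_dvd m).1 h1)
    have hshift : ∑ u : rootsOfUnity k ℂ, ((u : ℂˣ) : ℂ) ^ m
        = ((u₀ : ℂˣ) : ℂ) ^ m * ∑ u : rootsOfUnity k ℂ, ((u : ℂˣ) : ℂ) ^ m := by
      rw [Finset.mul_sum]
      refine (Fintype.sum_equiv (Equiv.mulLeft u₀) _ _ fun u => ?_).symm
      rw [← mul_zpow]
      rfl
    by_contra h0
    exact hu₀ (mul_right_cancel₀ h0 (by rw [one_mul]; exact hshift.symm))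

namespace CyclicWreath

variable {k n : ℕ} {C : Type*} (p : C → ℤ)

/-- The scalar by which the diagonal matrix `v` acts on the word `g`. -/
noncomputable def diagWeight (v : Fin n → rootsOfUnity k ℂ) (g : Fin n → C) : ℂ :=
  ∏ i, ((v i : ℂˣ) : ℂ) ^ p (g i)

variable (O : Finset (Fin n → C)) (hO : ∀ g ∈ O, ∀ π : Equiv.Perm (Fin n), g ∘ π ∈ O)

/-- The monomial representation on the functions on a finite set of words that is closed under
permutations of the places. -/
noncomputable def wordRep : Representation ℂ (CyclicWreath k n) (O → ℂ) where
  toFun σ :=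
    { toFun := fun φ h => diagWeight p σ.left h.1 * φ ⟨h.1 ∘ σ.right, hO _ h.2 _⟩
      map_add' := fun φ ψ => funext fun h => mul_add _ _ _
      map_smul' := fun c φ => funext fun h => mul_left_comm _ _ _ }
  map_one' := by
    refine LinearMap.ext fun φ => funext fun h => ?_
    change diagWeight p (1 : Fin n → rootsOfUnity k ℂ) h.1 * φ ⟨h.1 ∘ _, _⟩ = φ h
    have h1 : diagWeight p (1 : Fin n → rootsOfUnity k ℂ) h.1 = 1 := by simp [diagWeight]
    rw [h1, one_mul]
    rfl
  map_mul' σ τ := by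
    refine LinearMap.ext fun φ => funext fun h => ?_
    change diagWeight p (σ * τ).left h.1 * φ ⟨h.1 ∘ _, _⟩ = diagWeight p σ.left h.1 *
      (diagWeight p τ.left (h.1 ∘ σ.right) * φ ⟨(h.1 ∘ σ.right) ∘ τ.right, _⟩)
    rw [← mul_assoc]
    congr 1
    rw [SemidirectProduct.mul_left]
    simp only [diagWeight]
    rw [← Equiv.prod_comp σ.right⁻¹ fun i => ((τ.left i : ℂˣ) : ℂ) ^ p ((h.1 ∘ σ.right) i),
      ← Finset.prod_mul_distrib]
    refine Finset.prod_congr rfl fun i _ => ?_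
    have h1 : (h.1 ∘ σ.right) (σ.right⁻¹ i) = h.1 i := by simp
    rw [h1, ← mul_zpow]
    rfl

theorem wordRep_apply (σ : CyclicWreath k n) (φ : O → ℂ) (h : O) :
    wordRep p O hO σ φ h = diagWeight p σ.left h.1 * φ ⟨h.1 ∘ σ.right, hO _ h.2 _⟩ := rfl

open Classical in
theorem character_wordRep (σ : CyclicWreath k n) :
    (wordRep p O hO).character σ
      = ∑ g ∈ O, if g ∘ σ.right = g then diagWeight p σ.left g else 0 := by
  rw [Representation.character, LinearMap.trace_eq_matrix_trace ℂ (Pi.basisFun ℂ O), Matrix.trace,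
    ← Finset.sum_coe_sort O]
  refine Finset.sum_congr rfl fun h _ => ?_
  rw [Matrix.diag_apply, LinearMap.toMatrix_apply, Pi.basisFun_repr, wordRep_apply,
    Pi.basisFun_apply, Pi.single_apply, mul_ite, mul_one, mul_zero]
  simp only [Subtype.ext_iff]

theorem character_wordRep_inv [NeZero k] (σ : CyclicWreath k n) :
    (wordRep p O hO).character σ⁻¹ = starRingEnd ℂ ((wordRep p O hO).character σ) := by
  classical
  rw [character_wordRep, character_wordRep, map_sum]
  refine Finset.sum_congr rfl fun g _ => ?_
  have hiff : g ∘ ⇑(σ⁻¹).right = g ↔ g ∘ σ.right = g := by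
    rw [SemidirectProduct.inv_right]
    constructor
    · intro h
      conv_lhs => rw [← h]
      ext i
      simp
    · intro h
      conv_lhs => rw [← h]
      ext i
      simp
  by_cases h : g ∘ σ.right = g
  · rw [if_pos h, if_pos (hiff.2 h), diagWeight, diagWeight, map_prod,
      ← Equiv.prod_comp σ.right fun i => starRingEnd ℂ (((σ.left i : ℂˣ) : ℂ) ^ p (g i))]
    refine Finset.prod_congr rfl fun i _ => ?_
    have hi : g (σ.right i) = g i := congrFun h i
    have hl : (σ⁻¹).left i = (σ.left (σ.right i))⁻¹ := by
      rw [SemidirectProduct.inv_left]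
      change (σ.left ((σ.right⁻¹)⁻¹ i))⁻¹ = _
      rw [inv_inv]
    rw [hi, hl, map_zpow₀, Complex.conj_rootsOfUnity (σ.left (σ.right i)).2]
    simp
  · rw [if_neg h, if_neg fun h' => h (hiff.1 h'), map_zero]

end CyclicWreath

namespace Multipartition

open CyclicWreath

variable {k n : ℕ} [NeZero k] (γ : Multipartition k n) {C : Type*} (p : C → ℤ)

/-- The values of the letters of `g` are congruent modulo `k` to the components of their cells. -/
def HasValues (g : Fin n → C) : Prop := ∀ i, p (g i) ≡ (γ.comp i : ℤ) [ZMOD k]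

theorem sum_diagCoeff_mul_diagWeight_eq_prod (g : Fin n → C) :
    ∑ v, γ.diagCoeff v * diagWeight p v g
      = ∏ i, ∑ u : rootsOfUnity k ℂ, ((u : ℂˣ) : ℂ) ^ (p (g i) - (γ.comp i : ℤ)) := by
  classical
  rw [Finset.prod_univ_sum, Fintype.piFinset_univ]
  refine Finset.sum_congr rfl fun v _ => ?_
  rw [diagCoeff, diagWeight, ← Finset.prod_mul_distrib]
  refine Finset.prod_congr rfl fun i _ => ?_
  rw [zpow_sub₀ (Units.ne_zero _), zpow_natCast, mul_comm, div_eq_mul_inv]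

theorem sum_diagCoeff_mul_diagWeight_comp {π : Equiv.Perm (Fin n)}
    (hπ : ∀ i, γ.comp (π i) = γ.comp i) (g : Fin n → C) :
    ∑ v, γ.diagCoeff v * diagWeight p v (g ∘ π) = ∑ v, γ.diagCoeff v * diagWeight p v g := by
  rw [sum_diagCoeff_mul_diagWeight_eq_prod, sum_diagCoeff_mul_diagWeight_eq_prod,
    ← Equiv.prod_comp π fun i =>
      ∑ u : rootsOfUnity k ℂ, ((u : ℂˣ) : ℂ) ^ (p (g i) - (γ.comp i : ℤ))]
  exact Finset.prod_congr rfl fun i _ => by rw [hπ, Function.comp_apply]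

/-- Orthogonality of the characters of `Z_k ^ n`. -/
theorem sum_diagCoeff_mul_diagWeight_ne_zero (g : Fin n → C) :
    (∑ v, γ.diagCoeff v * diagWeight p v g) ≠ 0 ↔ γ.HasValues p g := by
  rw [sum_diagCoeff_mul_diagWeight_eq_prod, Finset.prod_ne_zero_iff]
  simp only [sum_rootsOfUnity_zpow, Finset.mem_univ, true_imp_iff]
  refine forall_congr' fun i => ?_
  rw [Int.modEq_comm, Int.modEq_iff_dvd]
  have hcard : (Fintype.card (rootsOfUnity k ℂ) : ℂ) ≠ 0 :=
    Nat.cast_ne_zero.2 Fintype.card_ne_zero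
  simp [hcard]

variable [LinearOrder C] (O : Finset (Fin n → C))
  (hO : ∀ g ∈ O, ∀ π : Equiv.Perm (Fin n), g ∘ π ∈ O)

theorem asAlgebraHom_youngSymmetrizer_single (T : O) :
    (wordRep p O hO).asAlgebraHom γ.youngSymmetrizer (Pi.single T 1)
      = (∑ v, γ.diagCoeff v * diagWeight p v T.1) • γ.tabVector O T.1 := by
  classical
  ext h
  have hexp : (wordRep p O hO).asAlgebraHom γ.youngSymmetrizer (Pi.single T 1) h
      = (∑ v, γ.diagCoeff v * diagWeight p v h.1) * ∑ q ∈ γ.colPerms, ∑ r ∈ γ.rowPerms,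
        ((Equiv.Perm.sign q : ℤ) : ℂ) * if h.1 ∘ r ∘ q = T.1 then 1 else 0 := by
    rw [youngSymmetrizer, Finset.sum_mul]
    simp only [map_sum, Representation.asAlgebraHom_single, LinearMap.sum_apply, Finset.sum_apply,
      LinearMap.smul_apply, Pi.smul_apply, wordRep_apply, smul_eq_mul, Pi.single_apply,
      Subtype.ext_iff, Finset.mul_sum]
    refine Finset.sum_congr rfl fun v _ => ?_
    rw [Finset.sum_comm]
    refine Finset.sum_congr rfl fun q _ => Finset.sum_congr rfl fun r _ => ?_
    rw [diagCoeff, Equiv.Perm.coe_mul]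
    ring
  have hinv : ∑ q ∈ γ.colPerms, ∑ r ∈ γ.rowPerms,
        ((Equiv.Perm.sign q : ℤ) : ℂ) * (if h.1 ∘ r ∘ q = T.1 then 1 else 0)
      = γ.tabVector O T.1 h := by
    refine Finset.sum_bij' (fun q _ => q⁻¹) (fun q _ => q⁻¹) (fun q hq => γ.inv_mem_colPerms hq)
      (fun q hq => γ.inv_mem_colPerms hq) (fun q _ => inv_inv q) (fun q _ => inv_inv q) ?_
    intro q _
    refine Finset.sum_bij' (fun r _ => r⁻¹) (fun r _ => r⁻¹) (fun r hr => γ.inv_mem_rowPerms hr)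
      (fun r hr => γ.inv_mem_rowPerms hr) (fun r _ => inv_inv r) (fun r _ => inv_inv r) ?_
    intro r _
    rw [Equiv.Perm.sign_inv]
    congr 1
    refine if_congr ⟨fun hw => ?_, fun hw => ?_⟩ rfl rfl
    · rw [← hw]; ext i; simp
    · rw [← hw]; ext i; simp
  rw [hexp, hinv, Pi.smul_apply, smul_eq_mul]
  -- where the vector of `T` does not vanish, the word `h` is a rearrangement of `T` that
  -- preserves the components
  simp only [tabVector, Finset.mul_sum]
  refine Finset.sum_congr rfl fun q hq => Finset.sum_congr rfl fun r hr => ?_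
  by_cases hw : T.1 ∘ q ∘ r = h.1
  · rw [← hw, ← Function.comp_assoc, γ.sum_diagCoeff_mul_diagWeight_comp p
      (γ.comp_of_mem_rowPerms hr), γ.sum_diagCoeff_mul_diagWeight_comp p
      (γ.comp_of_mem_colPerms hq)]
  · rw [if_neg hw, mul_zero, mul_zero, mul_zero]

theorem finrank_range_youngSymmetrizer :
    Module.finrank ℂ (LinearMap.range ((wordRep p O hO).asAlgebraHom γ.youngSymmetrizer))
      = {S | S ∈ O ∧ γ.HasValues p S ∧ γ.IsSemistandard S}.ncard := by
  classical
  have hspan : LinearMap.range ((wordRep p O hO).asAlgebraHom γ.youngSymmetrizer)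
      = Submodule.span ℂ (γ.tabVector O ''
        {S | S ∈ O ∧ γ.HasValues p S ∧ γ.IsSemistandard S}) := by
    rw [LinearMap.range_eq_map, ← (Pi.basisFun ℂ O).span_eq, Submodule.map_span, ← Set.range_comp]
    refine le_antisymm (Submodule.span_le.2 ?_) (Submodule.span_le.2 ?_)
    · rintro _ ⟨T, rfl⟩
      rw [Function.comp_apply, Pi.basisFun_apply, asAlgebraHom_youngSymmetrizer_single]
      by_cases hT : γ.HasValues p T.1
      · exact Submodule.smul_mem _ _ (γ.tabVector_mem_span O hO
          (fun r c => p c ≡ (r : ℤ) [ZMOD k]) T.2 hT)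
      · rw [← sum_diagCoeff_mul_diagWeight_ne_zero, not_not] at hT
        rw [hT, zero_smul]
        exact Submodule.zero_mem _
    · rintro _ ⟨S, ⟨hS, hSv, -⟩, rfl⟩
      have hne := (γ.sum_diagCoeff_mul_diagWeight_ne_zero p S).2 hSv
      refine (Submodule.smul_mem_iff _ hne).1 (Submodule.subset_span ⟨⟨S, hS⟩, ?_⟩)
      rw [Function.comp_apply, Pi.basisFun_apply, asAlgebraHom_youngSymmetrizer_single]
  set X := {S | S ∈ O ∧ γ.HasValues p S ∧ γ.IsSemistandard S} with hX
  have hXfin : X.Finite := O.finite_toSet.subset fun S hS => hS.1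
  have hfin : Fintype X := hXfin.fintype
  have hind : LinearIndependent ℂ fun S : X => γ.tabVector O S.1 :=
    (γ.linearIndependent_tabVector O).comp
      (fun S : X => (⟨S.1, S.2.1, S.2.2.2⟩ : {S : Fin n → C // S ∈ O ∧ γ.IsSemistandard S}))
      fun S T hST => Subtype.ext (congrArg (fun U => U.1) hST)
  rw [hspan, Set.image_eq_range, finrank_span_eq_card hind, ← Nat.card_coe_set_eq,
    Nat.card_eq_fintype_card]

open Classical in
/-- The number of semistandard words in a finite set of words that is closed under permutations of
the places. -/
theorem sum_mul_conj_irrChar_eq_ncard (hO : ∀ g ∈ O, ∀ π : Equiv.Perm (Fin n), g ∘ π ∈ O) :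
    ∑ g ∈ O, ∑ σ : CyclicWreath k n,
        (if g ∘ σ.right = g then diagWeight p σ.left g else 0) * starRingEnd ℂ (γ.irrChar σ)
      = (Fintype.card (CyclicWreath k n) : ℂ)
        * {S | S ∈ O ∧ γ.HasValues p S ∧ γ.IsSemistandard S}.ncard := by
  rw [← finrank_range_youngSymmetrizer γ p O hO,
    ← sum_character_mul_conj_irrChar γ _ (character_wordRep_inv p O hO), Finset.sum_comm]
  refine Finset.sum_congr rfl fun σ _ => ?_
  rw [character_wordRep, Finset.sum_mul]
  exact Finset.sum_congr rfl fun g _ => by congr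

end Multipartition

/-! ### Rearranging an unordered sum along finite orbits -/

open Filter Topology in
/-- Let `W` be partitioned into finite classes of bounded size on each of which `w` is constant.
If the sum that distributes the weight of the elements of `d` evenly over their classes converges,
then so does the sum over `d`, to the same value. (The ring need not be complete.) On saturated
finite sets the two sums agree. The remaining part of a large finite set splits into boundedly many
parts, on each of which the two summands are proportional, so its sum is small. -/
theorem hasSum_of_hasSum_average {W R : Type*} [CommRing R] [Algebra ℂ R] [TopologicalSpace R]
    [IsTopologicalRing R] (orb : W → Finset W) (hself : ∀ g, g ∈ orb g)
    (horb : ∀ g, ∀ h ∈ orb g, orb h = orb g) (N : ℕ) (hN : ∀ g, (orb g).card ≤ N)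
    (w : W → R) (hw : ∀ g, ∀ h ∈ orb g, w h = w g) (d : W → Prop) [DecidablePred d] {a : R}
    (h : HasSum (fun g => algebraMap ℂ R (((orb g).filter d).card / (orb g).card) * w g) a) :
    HasSum (fun g => if d g then w g else 0) a := by
  classical
  set f : W → R := fun g => algebraMap ℂ R (((orb g).filter d).card / (orb g).card) * w g with hf
  set f' : W → R := fun g => if d g then w g else 0 with hf'
  let ratio : W → ℂ := fun g => if d g then (orb g).card / ((orb g).filter d).card else 0
  let ratios : Finset ℂ := insert 0 ((Finset.range (N + 1) ×ˢ Finset.range (N + 1)).image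
    fun x => (x.1 : ℂ) / x.2)
  have hcard : ∀ g, ((orb g).card : ℂ) ≠ 0 := fun g =>
    Nat.cast_ne_zero.2 (Finset.card_pos.2 ⟨g, hself g⟩).ne'
  have hratio : ∀ g, ratio g ∈ ratios := by
    intro g
    by_cases hd : d g
    · refine Finset.mem_insert_of_mem (Finset.mem_image.2
        ⟨((orb g).card, ((orb g).filter d).card), ?_, by simp [ratio, hd]⟩)
      have h1 := hN g
      have h2 := Finset.card_filter_le (orb g) d
      rw [Finset.mem_product, Finset.mem_range, Finset.mem_range]
      exact ⟨by simpa using by omega, by simpa using by omega⟩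
    · simp [ratio, ratios, hd]
  have hff' : ∀ g, f' g = algebraMap ℂ R (ratio g) * f g := by
    intro g
    by_cases hd : d g
    · have h1 : (((orb g).filter d).card : ℂ) ≠ 0 :=
        Nat.cast_ne_zero.2 (Finset.card_pos.2 ⟨g, Finset.mem_filter.2 ⟨hself g, hd⟩⟩).ne'
      have h2 := hcard g
      simp only [hf, hf', ratio, if_pos hd]
      rw [← mul_assoc, ← map_mul, div_mul_div_cancel₀ h1, div_self h2, map_one, one_mul]
    · simp [hf', ratio, hd]
  -- the largest saturated subset of a finite set
  let core : Finset W → Finset W := fun s => s.filter fun g => orb g ⊆ s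
  have hcore : Tendsto core atTop atTop := by
    refine tendsto_atTop.2 fun s₀ => eventually_atTop.2 ⟨s₀.biUnion orb, fun s hs g hg => ?_⟩
    have hsub : orb g ⊆ s := (Finset.subset_biUnion_of_mem orb hg).trans hs
    exact Finset.mem_filter.2 ⟨hsub (hself g), hsub⟩
  have hcoresum : ∀ s, ∑ g ∈ core s, f' g = ∑ g ∈ core s, f g := by
    intro s
    have hmaps : ∀ g ∈ core s, orb g ∈ (core s).image orb :=
      fun g hg => Finset.mem_image_of_mem _ hg
    rw [← Finset.sum_fiberwise_of_maps_to hmaps, ← Finset.sum_fiberwise_of_maps_to hmaps]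
    refine Finset.sum_congr rfl fun o ho => ?_
    obtain ⟨g, hg, rfl⟩ := Finset.mem_image.1 ho
    have hfib : (core s).filter (fun h => orb h = orb g) = orb g := by
      ext x
      rw [Finset.mem_filter, Finset.mem_filter]
      constructor
      · rintro ⟨-, hx⟩
        exact hx ▸ hself x
      · intro hx
        have := horb g x hx
        have hgs := (Finset.mem_filter.1 hg).2
        exact ⟨⟨hgs hx, this ▸ hgs⟩, this⟩
    rw [hfib]
    have h1 : ∑ x ∈ orb g, f' x = ((orb g).filter d).card • w g := by
      rw [hf', ← Finset.sum_filter, ← Finset.sum_const]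
      exact Finset.sum_congr rfl fun x hx => hw g x (Finset.mem_filter.1 hx).1
    have h2 : ∑ x ∈ orb g, f x = (orb g).card • f g := by
      rw [← Finset.sum_const]
      exact Finset.sum_congr rfl fun x hx => by simp only [hf]; rw [horb g x hx, hw g x hx]
    rw [h1, h2]
    simp only [hf]
    rw [nsmul_eq_mul, nsmul_eq_mul, ← map_natCast (algebraMap ℂ R) (orb g).card, ← mul_assoc,
      ← map_mul, mul_div_cancel₀ _ (hcard g), map_natCast]
  have hrest : Tendsto (fun s => ∑ g ∈ s \ core s, f' g) atTop (𝓝 0) := by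
    have hsplit : ∀ s, ∑ g ∈ s \ core s, f' g = ∑ t ∈ ratios,
        algebraMap ℂ R t * ∑ g ∈ (s \ core s).filter (fun g => ratio g = t), f g := by
      intro s
      rw [← Finset.sum_fiberwise_of_maps_to (t := ratios) (g := ratio) fun g _ => hratio g]
      refine Finset.sum_congr rfl fun t _ => ?_
      rw [Finset.mul_sum]
      exact Finset.sum_congr rfl fun g hg => by rw [hff', (Finset.mem_filter.1 hg).2]
    simp only [hsplit]
    rw [← Finset.sum_const_zero (s := ratios)]
    refine tendsto_finsetSum _ fun t _ => ?_
    rw [← mul_zero (algebraMap ℂ R t)]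
    refine Tendsto.const_mul _ ?_
    refine tendsto_def.2 fun U hU => ?_
    obtain ⟨s₀, hs₀⟩ := h.summable.vanishing hU
    filter_upwards [hcore.eventually (eventually_ge_atTop s₀)] with s hs
    refine hs₀ _ (Finset.disjoint_left.2 fun g hg hg₀ => ?_)
    exact (Finset.mem_sdiff.1 (Finset.mem_filter.1 hg).1).2 (hs hg₀)
  have hmain : Tendsto (fun s => ∑ g ∈ core s, f' g) atTop (𝓝 a) := by
    simp only [hcoresum]
    have h' : Tendsto (fun s => ∑ g ∈ s, f g) atTop (𝓝 a) := h
    exact h'.comp hcore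
  have htot := hmain.add hrest
  rw [add_zero] at htot
  refine htot.congr fun s => ?_
  rw [add_comm]
  exact Finset.sum_sdiff (Finset.filter_subset _ _)

/-! ### Colorings and tableaux as words -/

namespace Multipartition

open CyclicWreath

variable {k n : ℕ} [NeZero k] (γ : Multipartition k n) {C : Type*} (p : C → ℤ)

open Classical in
/-- The sum, over the elements of the wreath product whose permutation fixes the word `g`, of the
scalar by which they act on `g` times the conjugate of `χ^γ`. -/
noncomputable def wordCoeff (g : Fin n → C) : ℂ :=
  ∑ σ : CyclicWreath k n,
    (if g ∘ σ.right = g then diagWeight p σ.left g else 0) * starRingEnd ℂ (γ.irrChar σ)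

theorem wordCoeff_comp (g : Fin n → C) (τ : Equiv.Perm (Fin n)) :
    γ.wordCoeff p (g ∘ τ) = γ.wordCoeff p g := by
  classical
  refine Fintype.sum_equiv (MulAut.conj (SemidirectProduct.inr τ : CyclicWreath k n)).toEquiv
    _ _ fun σ => ?_
  change _ = (if g ∘ (SemidirectProduct.inr τ * σ * (SemidirectProduct.inr τ)⁻¹).right = g then
    diagWeight p (SemidirectProduct.inr τ * σ * (SemidirectProduct.inr τ)⁻¹).left g else 0) *
      starRingEnd ℂ (γ.irrChar (SemidirectProduct.inr τ * σ * (SemidirectProduct.inr τ)⁻¹))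
  rw [irrChar_conj]
  congr 1
  refine if_congr ?_ ?_ rfl
  · rw [SemidirectProduct.mul_right, SemidirectProduct.mul_right, SemidirectProduct.inv_right,
      SemidirectProduct.right_inr]
    constructor
    · intro h
      ext i
      have := congrFun h (τ⁻¹ i)
      simpa using this
    · intro h
      ext i
      have := congrFun h (τ i)
      simpa using this
  · simp only [diagWeight]
    rw [← Equiv.prod_comp τ fun i => (((SemidirectProduct.inr τ * σ *
      (SemidirectProduct.inr τ)⁻¹ : CyclicWreath k n).left i : ℂˣ) : ℂ) ^ p (g i)]
    refine Finset.prod_congr rfl fun i _ => ?_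
    have hl : (SemidirectProduct.inr τ * σ * (SemidirectProduct.inr τ)⁻¹ :
        CyclicWreath k n).left (τ i) = σ.left i := by
      rw [← map_inv, SemidirectProduct.mul_left, SemidirectProduct.mul_left,
        SemidirectProduct.left_inr, SemidirectProduct.left_inr, SemidirectProduct.right_inr,
        map_one, one_mul, mul_one]
      change σ.left (τ⁻¹ (τ i)) = σ.left i
      simp
    rw [hl, Function.comp_apply]

variable [LinearOrder C]

/-- The rearrangements of a word. -/
def wordOrbit (g : Fin n → C) : Finset (Fin n → C) :=
  Finset.univ.image fun π : Equiv.Perm (Fin n) => g ∘ π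

theorem mem_wordOrbit {g h : Fin n → C} :
    h ∈ wordOrbit g ↔ ∃ π : Equiv.Perm (Fin n), g ∘ π = h := by simp [wordOrbit]

theorem wordOrbit_eq {g h : Fin n → C} (hh : h ∈ wordOrbit g) : wordOrbit h = wordOrbit g := by
  obtain ⟨π, rfl⟩ := mem_wordOrbit.1 hh
  ext x
  simp only [mem_wordOrbit]
  constructor
  · rintro ⟨τ, rfl⟩
    exact ⟨π * τ, rfl⟩
  · rintro ⟨τ, rfl⟩
    refine ⟨π⁻¹ * τ, ?_⟩
    ext i
    simp

open Classical in
/-- The coefficient of a word is constant on its rearrangements, and the sum over the rearrangements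
is known. -/
theorem wordCoeff_eq (g : Fin n → C) :
    (Fintype.card (CyclicWreath k n) : ℂ)⁻¹ * γ.wordCoeff p g
      = ((wordOrbit g).filter fun S => γ.HasValues p S ∧ γ.IsSemistandard S).card
        / (wordOrbit g).card := by
  have hO : ∀ h ∈ wordOrbit g, ∀ π : Equiv.Perm (Fin n), h ∘ π ∈ wordOrbit g := by
    intro h hh π
    rw [← wordOrbit_eq hh]
    exact mem_wordOrbit.2 ⟨π, rfl⟩
  have hsum := γ.sum_mul_conj_irrChar_eq_ncard p (wordOrbit g) hO
  have hconst : ∀ h ∈ wordOrbit g, γ.wordCoeff p h = γ.wordCoeff p g := by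
    intro h hh
    obtain ⟨π, rfl⟩ := mem_wordOrbit.1 hh
    exact γ.wordCoeff_comp p g π
  have hset : {S | S ∈ wordOrbit g ∧ γ.HasValues p S ∧ γ.IsSemistandard S}
      = ((wordOrbit g).filter fun S => γ.HasValues p S ∧ γ.IsSemistandard S :
        Finset (Fin n → C)) := by
    ext S; simp
  rw [hset, Set.ncard_coe_finset] at hsum
  have hsum' : ((wordOrbit g).card : ℂ) * γ.wordCoeff p g
      = (Fintype.card (CyclicWreath k n) : ℂ)
        * ((wordOrbit g).filter fun S => γ.HasValues p S ∧ γ.IsSemistandard S).card := by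
    rw [← hsum, ← nsmul_eq_mul, ← Finset.sum_const]
    refine Finset.sum_congr rfl fun h hh => ?_
    rw [← hconst h hh, wordCoeff]
    exact Finset.sum_congr rfl fun σ _ => by congr
  have h1 : ((wordOrbit g).card : ℂ) ≠ 0 :=
    Nat.cast_ne_zero.2 (Finset.card_pos.2 ⟨g, mem_wordOrbit.2 ⟨1, rfl⟩⟩).ne'
  have h2 : (Fintype.card (CyclicWreath k n) : ℂ) ≠ 0 := Nat.cast_ne_zero.2 Fintype.card_ne_zero
  rw [eq_div_iff h1, inv_mul_eq_div, div_mul_eq_mul_div, div_eq_iff h2, mul_comm, hsum', mul_comm]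

end Multipartition

namespace ColorRule

open CyclicWreath

variable {k n : ℕ} {C : Type*}

/-- No color is used in the word `g` more often than `F` allows. -/
def Allows (F : ColorRule C) (g : Fin n → C) : Prop := ∀ c, Set.ncard {i | g i = c} ≤ F c

theorem allows_comp_iff (F : ColorRule C) (g : Fin n → C) (π : Equiv.Perm (Fin n)) :
    F.Allows (g ∘ π) ↔ F.Allows g := by
  refine forall_congr' fun c => ?_
  have h : {i | (g ∘ π) i = c} = π ⁻¹' {i | g i = c} := rfl
  rw [h, Set.ncard_preimage_of_injective_subset_range π.injective (by simp)]

theorem forall_sameCycle_iff {π : Equiv.Perm (Fin n)} {g : Fin n → C} :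
    (∀ i j, π.SameCycle i j → g i = g j) ↔ g ∘ π = g := by
  constructor
  · intro h
    ext i
    exact (h i (π i) ⟨1, by simp⟩).symm
  · intro h i j hij
    obtain ⟨m, -, -, rfl⟩ := hij.exists_pow_eq'
    have hm : ∀ m : ℕ, g ((π ^ m) i) = g i := by
      intro m
      induction m with
      | zero => rfl
      | succ m ih => rw [pow_succ', Equiv.Perm.mul_apply, ← ih]; exact congrFun h _
    exact (hm m).symm

theorem colorWeight_eq {R : Type*} [CommRing R] [Algebra ℂ R] (p : C → ℤ) (ρ : C → R)
    (σ : CyclicWreath k n) (g : Fin n → C) :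
    colorWeight p ρ σ g = algebraMap ℂ R (diagWeight p σ.left g) * ∏ i, ρ (g i) := by
  rw [colorWeight, Finset.prod_mul_distrib, diagWeight, map_prod]

end ColorRule

namespace ColorRule

open CyclicWreath

variable {k n : ℕ} {C : Type*}

/-- The inner product of `χ` with `χ^γ` as one sum over all words. -/
theorem hasSum_wreathInner [NeZero k] {R : Type*} [CommRing R] [Algebra ℂ R]
    [TopologicalSpace R] [IsTopologicalRing R] (F : ColorRule C) (p : C → ℤ) (ρ : C → R)
    (χ : CyclicWreath k n → R) (hχ : F.Gives p ρ χ) (γ : Multipartition k n)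
    [DecidablePred fun g : Fin n → C => F.Allows g] :
    HasSum (fun g : Fin n → C => algebraMap ℂ R
      ((Fintype.card (CyclicWreath k n) : ℂ)⁻¹ * γ.wordCoeff p g)
        * if F.Allows g then ∏ i, ρ (g i) else 0) (wreathInner χ γ.irrChar) := by
  classical
  have hσ : ∀ σ : CyclicWreath k n, HasSum (fun g : Fin n → C =>
      if F.Allows g ∧ g ∘ σ.right = g then colorWeight p ρ σ g else 0) (χ σ) := by
    intro σ
    have h1 : HasSum ((fun g : Fin n → C => colorWeight p ρ σ g) ∘
      ((↑) : {g : Fin n → C | (∀ c, Set.ncard {i | g i = c} ≤ F c) ∧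
        ∀ i j, σ.right.SameCycle i j → g i = g j} → (Fin n → C))) (χ σ) := hχ σ
    rw [hasSum_subtype_iff_indicator] at h1
    refine h1.congr_fun fun g => ?_
    rw [Set.indicator_apply]
    exact if_congr (and_congr Iff.rfl forall_sameCycle_iff.symm) rfl rfl
  have hsum := (hasSum_sum fun σ (_ : σ ∈ Finset.univ) =>
    (hσ σ).mul_right (algebraMap ℂ R (starRingEnd ℂ (γ.irrChar σ)))).mul_left
      (algebraMap ℂ R (Fintype.card (CyclicWreath k n) : ℂ)⁻¹)
  rw [wreathInner, Algebra.smul_def]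
  refine hsum.congr_fun fun g => ?_
  rw [map_mul, mul_assoc, Multipartition.wordCoeff, map_sum, Finset.sum_mul]
  congr 1
  refine Finset.sum_congr rfl fun σ _ => ?_
  rw [map_mul]
  by_cases h1 : F.Allows g <;> by_cases h2 : g ∘ σ.right = g
  · rw [if_pos h2, if_pos h1, if_pos ⟨h1, h2⟩, colorWeight_eq]
    ring
  · simp [h2]
  · simp [h1]
  · simp [h1]

end ColorRule

namespace Multipartition

variable {k n : ℕ} (γ : Multipartition k n)

theorem comp_filling (x : γ.Cell) : γ.comp (γ.filling x) = x.1 := by simp [comp]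

theorem rowNum_filling (x : γ.Cell) : γ.rowNum (γ.filling x) = x.2.1.1 := by
  simp only [rowNum, row]
  rw [Equiv.symm_apply_apply]

theorem colNum_filling (x : γ.Cell) : γ.colNum (γ.filling x) = x.2.1.2 := by
  simp only [colNum, col]
  rw [Equiv.symm_apply_apply]

end Multipartition

namespace ColorRule

variable {k n : ℕ} {C : Type*}

theorem eq_comp_of_modEq {γ : Multipartition k n} {c : ℤ} {i : Fin n} {r : Fin k}
    (h : c ≡ (γ.comp i : ℤ) [ZMOD k]) (hr : c ≡ (r : ℤ) [ZMOD k]) : γ.comp i = r := by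
  have h1 := h.symm.trans hr
  rw [Int.natCast_modEq_iff] at h1
  exact Fin.ext (Nat.ModEq.eq_of_lt_of_lt h1 (γ.comp i).2 r.2)

/-- In a word with the right values, a color occurs only in the component of its value. -/
theorem ncard_cells_eq (γ : Multipartition k n) {p : C → ℤ} {g : Fin n → C}
    (hg : γ.HasValues p g) (c : C) (r : Fin k) :
    Set.ncard {x : (γ.shape r).cells | g (γ.filling ⟨r, x⟩) = c}
      = if p c ≡ (r : ℤ) [ZMOD k] then Set.ncard {i | g i = c} else 0 := by
  split_ifs with hr
  · have himg : {i | g i = c}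
        = (fun x => γ.filling ⟨r, x⟩) '' {x : (γ.shape r).cells | g (γ.filling ⟨r, x⟩) = c} := by
      ext i
      constructor
      · intro (hi : g i = c)
        have hcomp : γ.comp i = r := eq_comp_of_modEq (hi ▸ hg i) hr
        obtain ⟨⟨r', x⟩, rfl⟩ := γ.filling.surjective i
        rw [γ.comp_filling] at hcomp
        subst hcomp
        exact ⟨x, hi, rfl⟩
      · rintro ⟨x, hx, rfl⟩
        exact hx
    rw [himg, Set.ncard_image_of_injective]
    intro x y hxy
    simpa using hxy
  · rw [Set.ncard_eq_zero, Set.eq_empty_iff_forall_notMem]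
    intro x (hx : g _ = c)
    have := hg (γ.filling ⟨r, x⟩)
    rw [hx, γ.comp_filling] at this
    exact hr this

variable [LinearOrder C]

/-- The word of a tableau: its entries, listed by the indices in the cells. -/
noncomputable def tableauWord {F : ColorRule C} {p : C → ℤ} (γ : Multipartition k n) (T : F.SSYTk p γ) :
    Fin n → C := fun i => (T (γ.filling.symm i).1).1 (γ.filling.symm i).2

theorem tableauWord_filling {F : ColorRule C} {p : C → ℤ} (γ : Multipartition k n)
    (T : F.SSYTk p γ) (x : γ.Cell) : tableauWord γ T (γ.filling x) = (T x.1).1 x.2 := by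
  rw [tableauWord, Equiv.symm_apply_apply]

theorem tableauWord_injective {F : ColorRule C} {p : C → ℤ} (γ : Multipartition k n) :
    Function.Injective (tableauWord γ : F.SSYTk p γ → Fin n → C) := by
  intro T U h
  refine funext fun r => Subtype.ext (funext fun x => ?_)
  rw [← tableauWord_filling γ T ⟨r, x⟩, ← tableauWord_filling γ U ⟨r, x⟩, h]

theorem prod_tableauWord {R : Type*} [CommRing R] {F : ColorRule C} {p : C → ℤ}
    (γ : Multipartition k n) (ρ : C → R) (T : F.SSYTk p γ) :
    ∏ i, ρ (tableauWord γ T i) = tableauWeight ρ T := by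
  rw [tableauWeight, ← Equiv.prod_comp γ.filling, Fintype.prod_sigma]
  exact Finset.prod_congr rfl fun r _ => Finset.prod_congr rfl fun x _ => by
    rw [tableauWord_filling]

/-- The words of the tableaux are the semistandard words with the right values that use no color
too often. -/
theorem mem_range_tableauWord [NeZero k] (F : ColorRule C) (p : C → ℤ) (γ : Multipartition k n)
    (g : Fin n → C) :
    g ∈ Set.range (tableauWord γ : F.SSYTk p γ → Fin n → C)
      ↔ F.Allows g ∧ γ.HasValues p g ∧ γ.IsSemistandard g := by
  constructor
  · rintro ⟨T, rfl⟩
    have hvals : γ.HasValues p (tableauWord γ T) := by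
      intro i
      obtain ⟨⟨r, x⟩, rfl⟩ := γ.filling.surjective i
      rw [tableauWord_filling, γ.comp_filling]
      by_contra hcon
      have h := (T r).2.2.2 ((T r).1 x)
      rw [restrict, if_neg hcon, Nat.le_zero, Set.ncard_eq_zero] at h
      exact Set.notMem_empty x (h ▸ (rfl : (T r).1 x = (T r).1 x))
    refine ⟨fun c => ?_, hvals, fun i j hrow hcol => ?_, fun i j hcol hrow => ?_⟩
    · rcases Set.eq_empty_or_nonempty {i | tableauWord γ T i = c} with he | ⟨i, hi⟩
      · rw [he, Set.ncard_empty]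
        exact Nat.zero_le _
      · have hr : p c ≡ (γ.comp i : ℤ) [ZMOD k] := by
          have := hvals i
          rwa [show tableauWord γ T i = c from hi] at this
        have h1 := ncard_cells_eq γ hvals c (γ.comp i)
        have h2 := (T (γ.comp i)).2.2.2 c
        rw [if_pos hr] at h1
        rw [restrict, if_pos hr] at h2
        rw [← h1]
        simpa only [tableauWord_filling] using h2
    · obtain ⟨⟨r, x⟩, rfl⟩ := γ.filling.surjective i
      obtain ⟨⟨r', y⟩, rfl⟩ := γ.filling.surjective j
      rw [γ.row_eq_iff, γ.comp_filling, γ.comp_filling, γ.rowNum_filling,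
        γ.rowNum_filling] at hrow
      rw [γ.colNum_filling, γ.colNum_filling] at hcol
      obtain ⟨hr, hrow⟩ := hrow
      simp only at hr
      subst hr
      rw [tableauWord_filling, tableauWord_filling]
      exact (T r).2.1 x y hrow hcol
    · obtain ⟨⟨r, x⟩, rfl⟩ := γ.filling.surjective i
      obtain ⟨⟨r', y⟩, rfl⟩ := γ.filling.surjective j
      rw [γ.col_eq_iff, γ.comp_filling, γ.comp_filling, γ.colNum_filling,
        γ.colNum_filling] at hcol
      rw [γ.rowNum_filling, γ.rowNum_filling] at hrow
      obtain ⟨hr, hcol⟩ := hcol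
      simp only at hr
      subst hr
      rw [tableauWord_filling, tableauWord_filling]
      exact (T r).2.2.1 x y hcol hrow
  · rintro ⟨hF, hvals, hrow, hcol⟩
    refine ⟨fun r => ⟨fun x => g (γ.filling ⟨r, x⟩), fun x y h1 h2 => ?_, fun x y h1 h2 => ?_,
      fun c => ?_⟩, ?_⟩
    · refine hrow _ _ ?_ ?_
      · rw [γ.row_eq_iff, γ.comp_filling, γ.comp_filling, γ.rowNum_filling, γ.rowNum_filling]
        exact ⟨rfl, h1⟩
      · rw [γ.colNum_filling, γ.colNum_filling]
        exact h2
    · refine hcol _ _ ?_ ?_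
      · rw [γ.col_eq_iff, γ.comp_filling, γ.comp_filling, γ.colNum_filling, γ.colNum_filling]
        exact ⟨rfl, h1⟩
      · rw [γ.rowNum_filling, γ.rowNum_filling]
        exact h2
    · rw [ncard_cells_eq γ hvals c r, restrict]
      split_ifs
      · exact hF c
      · exact le_rfl
    · ext i
      simp [tableauWord]

end ColorRule

theorem mainTheorem1 {k n : ℕ} [NeZero k]
    {R : Type*} [CommRing R] [Algebra ℂ R] [TopologicalSpace R] [IsTopologicalRing R] [T2Space R]
    {C : Type*} [LinearOrder C] (F : ColorRule C) (p : C → ℤ) (ρ : C → R)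
    (χ : CyclicWreath k n → R) (hχ : F.Gives p ρ χ) (γ : Multipartition k n) :
    HasSum (fun T : F.SSYTk p γ => ColorRule.tableauWeight ρ T) (wreathInner χ γ.irrChar) := by
  classical
  have h := F.hasSum_wreathInner p ρ χ hχ γ
  simp only [γ.wordCoeff_eq p] at h
  have horb := hasSum_of_hasSum_average Multipartition.wordOrbit
    (fun g => Multipartition.mem_wordOrbit.2 ⟨1, rfl⟩)
    (fun g h hh => Multipartition.wordOrbit_eq hh)
    (Fintype.card (Equiv.Perm (Fin n))) (fun g => Finset.card_image_le)
    (fun g => if F.Allows g then ∏ i, ρ (g i) else 0)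
    (fun g h hh => by
      obtain ⟨π, rfl⟩ := Multipartition.mem_wordOrbit.1 hh
      refine if_congr (F.allows_comp_iff g π) ?_ rfl
      exact Equiv.prod_comp π fun i => ρ (g i))
    (fun g => γ.HasValues p g ∧ γ.IsSemistandard g) h
  rw [← (ColorRule.tableauWord_injective (F := F) (p := p) γ).hasSum_iff] at horb
  · refine horb.congr_fun fun T => ?_
    have hT := (ColorRule.mem_range_tableauWord F p γ _).1 ⟨T, rfl⟩
    rw [Function.comp_apply, if_pos hT.2, if_pos hT.1, ColorRule.prod_tableauWord]
  · intro g hg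
    rw [ColorRule.mem_range_tableauWord] at hg
    by_cases h1 : γ.HasValues p g ∧ γ.IsSemistandard g
    · rw [if_pos h1, if_neg fun h2 => hg ⟨h2, h1⟩]
    · rw [if_neg h1]
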